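/- Let $d\ge 1$ and $n_1\ge n_2\ge\cdots\ge n_d\ge 2$ be integers, $\Omega=\prod_{i=1}^d[n_i]$ and $N=\prod_{i=1}^d n_i$. Write $\|p-q\|_{\mathrm{TV}}=\frac12\sum_{x\in\Omega}|p(x)-q(x)|$; a distribution on $\Omega$ is a product distribution if it has the form $x\mapsto\prod_{i=1}^d q_i(x_i)$ with $q_i$ a distribution on $[n_i]$, and $p$ is $\varepsilon$-far from product if $\|p-q\|_{\mathrm{TV}}\ge\varepsilon$ for every product distribution $q$ on $\Omega$. An $(\alpha,\varepsilon,\delta)$-augmented independence tester is a randomized algorithm that receives an explicit prediction $\hat p$ (a distribution on $\Omega$) and i.i.d. samples from an unknown distribution $p$ on $\Omega$, answers accept, reject or inaccurate information, and satisfies for all $p$ and $\hat p$: (i) if $\|p-\hat p\|_{\mathrm{TV}}\le\alpha$, it answers inaccurate information with probability at most $\delta/2$; (ii) if $p$ is $\varepsilon$-far from product, it answers accept with probability at most $\delta/2$; (iii) if $p$ is a product distribution, it answers reject with probability at most $\delta/2$. Theorem. There is an absolute constant $C$ such that for all $d$ and $n_1\ge\cdots\ge n_d\ge2$ as above, all $\varepsilon\in(0,1)$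 and all $\alpha\in[0,1]$, there is an $(\alpha,\varepsilon,0.1)$-augmented independence tester for distributions on $\prod_{i=1}^d[n_i]$ that uses at most $$C\cdot\max\left\{\frac{\sqrt N}{\varepsilon^2},\ \frac{n_1^{1/3}N^{1/3}\alpha^{1/3}}{\varepsilon^{4/3}}\right\}$$ samples. -/

import Mathlib

namespace AugIndep

/-- The three possible answers of an augmented tester. -/
inductive Answer
  | accept
  | reject
  | inaccurateInformation

/-- The product domain `[n₁] × ⋯ × [n_d]`. -/
abbrev Domain {d : ℕ} (n : Fin d → ℕ) : Type := (i : Fin d) → Fin (n i)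

/-- Total variation distance between two distributions on a finite set. -/
noncomputable def tvDist {Ω : Type*} [Fintype Ω] (p q : PMF Ω) : ℝ :=
  (1 / 2) * ∑ x, |(p x).toReal - (q x).toReal|

/-- `p` is a product distribution: its `d` coordinates are mutually independent. -/
def IsProduct {d : ℕ} {n : Fin d → ℕ} (p : PMF (Domain n)) : Prop :=
  ∃ q : (i : Fin d) → PMF (Fin (n i)), ∀ x, p x = ∏ i, q i (x i)

/-- `p` is at distance at least `ε` from every product distribution. -/
def IsFarFromProduct {d : ℕ} {n : Fin d → ℕ} (ε : ℝ) (p : PMF (Domain n)) : Prop :=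
  ∀ q : PMF (Domain n), IsProduct q → ε ≤ tvDist p q

/-- A randomized algorithm that knows a prediction explicitly and draws `m` samples: for every
prediction and every sequence of `m` observed samples, the distribution of its answer. -/
abbrev Tester (m : ℕ) (Ω : Type*) : Type _ := PMF Ω → (Fin m → Ω) → PMF Answer

/-- The probability that `A`, given the prediction `phat` and `m` independent samples from `p`,
answers `o` (over the samples and the internal randomness of `A`). -/
noncomputable def Tester.prob {m : ℕ} {Ω : Type*} [Fintype Ω] (A : Tester m Ω)
    (phat p : PMF Ω) (o : Answer) : ℝ :=
  ∑ s : Fin m → Ω, (∏ j, (p (s j)).toReal) * (A phat s o).toReal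

/-- `(α, ε, δ)`-augmented independence tester: for all (unknown) distributions `p` and all
(known, arbitrarily bad) predictions `phat`, each kind of wrong answer has probability
at most `δ / 2`. -/
structure IsAugmentedIndependenceTester {d m : ℕ} {n : Fin d → ℕ} (α ε δ : ℝ)
    (A : Tester m (Domain n)) : Prop where
  of_accurate : ∀ p phat : PMF (Domain n), tvDist p phat ≤ α →
    A.prob phat p Answer.inaccurateInformation ≤ δ / 2
  of_far : ∀ p phat : PMF (Domain n), IsFarFromProduct ε p →
    A.prob phat p Answer.accept ≤ δ / 2
  of_product : ∀ p phat : PMF (Domain n), IsProduct p →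
    A.prob phat p Answer.reject ≤ δ / 2

end AugIndep

/-! The coordinates are grouped into three blocks: those before an index `k`, the coordinate `k`,
and those after it. By `exists_balanced_index` both outer blocks can have size at most √N. About
√N/ε² samples then learn the outer marginals in ℓ¹, so it can be checked directly whether each is
near a product. By `far_blocks`, if `p` is far from product, then an outer marginal is far from
product or `p` is far from the product of its three block marginals. It remains to test independence
of the three blocks.

For that, each block is flattened: a point `y` gets weight `1/b y`, where `b y` counts fractional
buckets assigned from the prediction and from one batch of samples. Weighting replaces random
splitting, so the tester is deterministic. An unbiased estimator of the weighted squared distance S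
between `P` and the product Q of its block marginals is compared with a threshold of order ε²/N. The
buckets have total size 27N, so Cauchy–Schwarz gives S ≥ ε²/(27N) in the far case. The variance is
governed by the weighted squared norm of Q (`Ex_pairAvg_innerKernel_sub_sq_le`), which factors over
the blocks.

The outer blocks have at most √N ≤ m points, so samples alone flatten them to norm O(1/size). The
middle block may be larger than `m`; there an accurate prediction leaves excess mass at most α, and
`Ex_flattened_norm_le` bounds the norm by 2/n_k + α/m. The tester estimates this norm and blames the
prediction when it is too large, so a bad prediction cannot spoil the other two guarantees.
Requiring the product of the three norms to be at most a small multiple of (mε²/N)² gives m²ε⁴ ≳ N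
and m³ε⁴ ≳ n_k N α. Since n_k ≤ n_1, these are the two terms of the stated bound. -/

namespace AugIndep

/-! ### Finite probability: moments, tail bounds and two-batch averages. -/

section FiniteProbability

variable {T T' : Type*} [Fintype T] [Fintype T']

/-- `P` is a probability weight function on a finite type. -/
structure IsProb (P : T → ℝ) : Prop where
  nonneg : ∀ t, 0 ≤ P t
  sum_eq_one : ∑ t, P t = 1

/-- Expectation of `F` under the weights `P`. -/
def Ex (P F : T → ℝ) : ℝ := ∑ t, P t * F t

open Classical in
/-- Probability of the event `E` under the weights `P`. -/
noncomputable def Pr (P : T → ℝ) (E : T → Prop) : ℝ := Ex P fun t => if E t then 1 else 0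

/-- Product weights on a product of two types. -/
def prodW (P : T → ℝ) (P' : T' → ℝ) : T × T' → ℝ := fun t => P t.1 * P' t.2

/-- Weights of `m` independent draws. -/
def powW (P : T → ℝ) (m : ℕ) : (Fin m → T) → ℝ := fun s => ∏ i, P (s i)

lemma Ex_add (P F G : T → ℝ) : Ex P (fun t => F t + G t) = Ex P F + Ex P G := by
  simp [Ex, mul_add, Finset.sum_add_distrib]

lemma Ex_sub (P F G : T → ℝ) : Ex P (fun t => F t - G t) = Ex P F - Ex P G := by
  simp [Ex, mul_sub, Finset.sum_sub_distrib]

lemma Ex_const_mul (P F : T → ℝ) (c : ℝ) : Ex P (fun t => c * F t) = c * Ex P F := by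
  simp only [Ex, Finset.mul_sum]
  exact Finset.sum_congr rfl fun t _ => by ring

lemma Ex_mul_const (P F : T → ℝ) (c : ℝ) : Ex P (fun t => F t * c) = Ex P F * c := by
  simp only [Ex, Finset.sum_mul]
  exact Finset.sum_congr rfl fun t _ => by ring

lemma Ex_sum {ι : Type*} (s : Finset ι) (P : T → ℝ) (F : ι → T → ℝ) :
    Ex P (fun t => ∑ i ∈ s, F i t) = ∑ i ∈ s, Ex P (F i) := by
  simp only [Ex, Finset.mul_sum]
  exact Finset.sum_comm

lemma Ex_const {P : T → ℝ} (hP : IsProb P) (c : ℝ) : Ex P (fun _ => c) = c := by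
  simp [Ex, ← Finset.sum_mul, hP.sum_eq_one]

lemma Ex_mono {P F G : T → ℝ} (hP : IsProb P) (h : ∀ t, F t ≤ G t) : Ex P F ≤ Ex P G :=
  Finset.sum_le_sum fun t _ => mul_le_mul_of_nonneg_left (h t) (hP.nonneg t)

lemma Ex_nonneg {P F : T → ℝ} (hP : IsProb P) (h : ∀ t, 0 ≤ F t) : 0 ≤ Ex P F :=
  Finset.sum_nonneg fun t _ => mul_nonneg (hP.nonneg t) (h t)

lemma Ex_prodW (P : T → ℝ) (P' : T' → ℝ) (F : T × T' → ℝ) :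
    Ex (prodW P P') F = Ex P fun a => Ex P' fun b => F (a, b) := by
  simp only [Ex, prodW, Fintype.sum_prod_type, Finset.mul_sum, mul_assoc]

lemma Ex_comm (P : T → ℝ) (P' : T' → ℝ) (F : T → T' → ℝ) :
    (Ex P fun a => Ex P' fun b => F a b) = Ex P' fun b => Ex P fun a => F a b := by
  simp only [Ex, Finset.mul_sum]
  rw [Finset.sum_comm]
  exact Finset.sum_congr rfl fun a _ => Finset.sum_congr rfl fun b _ => by ring

lemma IsProb.prodW {P : T → ℝ} {P' : T' → ℝ} (hP : IsProb P) (hP' : IsProb P') :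
    IsProb (prodW P P') where
  nonneg t := mul_nonneg (hP.nonneg _) (hP'.nonneg _)
  sum_eq_one := by
    simp [AugIndep.prodW, Fintype.sum_prod_type, ← Finset.mul_sum, hP.sum_eq_one, hP'.sum_eq_one]

lemma IsProb.powW {P : T → ℝ} (hP : IsProb P) (m : ℕ) : IsProb (powW P m) where
  nonneg s := Finset.prod_nonneg fun i _ => hP.nonneg _
  sum_eq_one := by
    simp only [AugIndep.powW]
    rw [← Fintype.sum_pow, hP.sum_eq_one, one_pow]

lemma Pr_mono {P : T → ℝ} (hP : IsProb P) {E E' : T → Prop} (h : ∀ t, E t → E' t) :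
    Pr P E ≤ Pr P E' := by
  classical
  refine Ex_mono hP fun t => ?_
  by_cases hE : E t
  · simp [hE, h t hE]
  · simp only [hE, if_false]
    split_ifs <;> norm_num

lemma Pr_or_le {P : T → ℝ} (hP : IsProb P) (E E' : T → Prop) :
    Pr P (fun t => E t ∨ E' t) ≤ Pr P E + Pr P E' := by
  classical
  rw [Pr, Pr, Pr, ← Ex_add]
  refine Ex_mono hP fun t => ?_
  by_cases hE : E t <;> by_cases hE' : E' t <;> simp [hE, hE']

/-- Markov's inequality. -/
lemma Pr_le_of_Ex_le {P F : T → ℝ} (hP : IsProb P) (hF : ∀ t, 0 ≤ F t) {c η : ℝ} (hc : 0 < c)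
    (h : Ex P F ≤ η * c) : Pr P (fun t => c ≤ F t) ≤ η := by
  classical
  have : Pr P (fun t => c ≤ F t) ≤ Ex P (fun t => F t * c⁻¹) := by
    refine Ex_mono hP fun t => ?_
    split_ifs with hE
    · rw [← div_eq_mul_inv]
      exact (one_le_div hc).2 hE
    · exact mul_nonneg (hF t) (inv_nonneg.2 hc.le)
  rw [Ex_mul_const] at this
  calc _ ≤ Ex P F * c⁻¹ := this
    _ ≤ η * c * c⁻¹ := by gcongr
    _ = η := by field_simp

/-- Chebyshev's inequality. -/
lemma Pr_abs_sub_le {P F : T → ℝ} (hP : IsProb P) {μ c η : ℝ} (hc : 0 < c)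
    (h : Ex P (fun t => (F t - μ) ^ 2) ≤ η * c ^ 2) : Pr P (fun t => c ≤ |F t - μ|) ≤ η := by
  refine (Pr_mono hP fun t ht => ?_).trans
    (Pr_le_of_Ex_le hP (fun t => sq_nonneg (F t - μ)) (pow_pos hc 2) h)
  rw [← sq_abs (F t - μ)]
  exact pow_le_pow_left₀ hc.le ht 2

lemma Pr_prodW_le {P : T → ℝ} {P' : T' → ℝ} (hP : IsProb P) {E : T × T' → Prop} {η : ℝ}
    (h : ∀ a, Pr P' (fun b => E (a, b)) ≤ η) : Pr (prodW P P') E ≤ η := by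
  classical
  rw [Pr, Ex_prodW]
  exact (Ex_mono hP h).trans_eq (Ex_const hP η)

lemma Pr_prodW_fst (P : T → ℝ) {P' : T' → ℝ} (hP' : IsProb P') (E : T → Prop) :
    Pr (prodW P P') (fun t => E t.1) = Pr P E := by
  classical
  rw [Pr, Ex_prodW]
  refine congrArg (Ex P) (funext fun a => ?_)
  by_cases h : E a <;> simp [h, Ex_const hP']

/-- Singling out one draw drives the moment inductions (with `j = 0`) and the exchangeability
argument in `marg_mul_Ex_inv_count_le` (with every `j`). -/
lemma Ex_powW_insertNth (P : T → ℝ) (m : ℕ) (j : Fin (m + 1)) (F : (Fin (m + 1) → T) → ℝ) :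
    Ex (powW P (m + 1)) F =
      Ex P fun a => Ex (powW P m) fun s => F (j.insertNth (α := fun _ => T) a s) := by
  rw [← Ex_prodW P (powW P m) fun t => F (j.insertNth (α := fun _ => T) t.1 t.2), Ex, Ex,
    ← (Fin.insertNthEquiv (fun _ => T) j).sum_comp]
  refine Finset.sum_congr rfl fun t _ => ?_
  rw [show (Fin.insertNthEquiv (fun _ => T) j) t = j.insertNth (α := fun _ => T) t.1 t.2 from rfl]
  simp [powW, prodW, Fin.prod_univ_succAbove _ j]

lemma Ex_powW_sum {P : T → ℝ} (hP : IsProb P) (m : ℕ) (G : T → ℝ) :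
    Ex (powW P m) (fun s => ∑ i, G (s i)) = m * Ex P G := by
  induction m with
  | zero => simp [Ex]
  | succ m ih =>
    rw [Ex_powW_insertNth P m 0]
    simp only [Fin.sum_univ_succAbove _ 0, Fin.insertNth_apply_same,
      Fin.insertNth_apply_succAbove, Ex_add,
      Ex_const (hP.powW m), ih, Ex_const hP]
    push_cast
    ring

lemma Ex_powW_sum_sq {P : T → ℝ} (hP : IsProb P) (m : ℕ) (G : T → ℝ) :
    Ex (powW P m) (fun s => (∑ i, G (s i)) ^ 2) =
      m * Ex P (fun t => G t ^ 2) + m * (m - 1) * Ex P G ^ 2 := by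
  induction m with
  | zero => simp [Ex]
  | succ m ih =>
    rw [Ex_powW_insertNth P m 0]
    simp only [Fin.sum_univ_succAbove _ 0, Fin.insertNth_apply_same,
      Fin.insertNth_apply_succAbove, add_sq, Ex_add,
      Ex_const (hP.powW m), ih, Ex_const hP, Ex_const_mul, Ex_powW_sum hP, Ex_mul_const]
    push_cast
    ring

/-- Average of `G` over `m` draws. -/
noncomputable def avg {m : ℕ} (G : T → ℝ) (s : Fin m → T) : ℝ := (m : ℝ)⁻¹ * ∑ i, G (s i)

lemma Ex_avg {P : T → ℝ} (hP : IsProb P) {m : ℕ} (hm : 0 < m) (G : T → ℝ) :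
    Ex (powW P m) (avg G) = Ex P G := by
  have : (m : ℝ) ≠ 0 := by positivity
  unfold avg
  rw [Ex_const_mul, Ex_powW_sum hP]
  field_simp

lemma Ex_avg_sq_le {P : T → ℝ} (hP : IsProb P) {m : ℕ} (hm : 0 < m) (G : T → ℝ) :
    Ex (powW P m) (fun s => avg G s ^ 2) ≤ (m : ℝ)⁻¹ * Ex P (fun t => G t ^ 2) + Ex P G ^ 2 := by
  have hm' : (0 : ℝ) < m := by positivity
  have h : Ex (powW P m) (fun s => avg G s ^ 2) =
      (m : ℝ)⁻¹ * Ex P (fun t => G t ^ 2) + Ex P G ^ 2 - (m : ℝ)⁻¹ * Ex P G ^ 2 := by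
    simp only [avg, mul_pow]
    rw [Ex_const_mul, Ex_powW_sum_sq hP]
    field_simp
    ring
  have : 0 ≤ (m : ℝ)⁻¹ * Ex P G ^ 2 := by positivity
  linarith

lemma Ex_sub_sq {P : T → ℝ} (hP : IsProb P) (F : T → ℝ) :
    Ex P (fun t => (F t - Ex P F) ^ 2) = Ex P (fun t => F t ^ 2) - Ex P F ^ 2 := by
  have : ∀ t, (F t - Ex P F) ^ 2 = F t ^ 2 - 2 * Ex P F * F t + Ex P F ^ 2 := fun t => by ring
  simp only [this]
  rw [Ex_add, Ex_sub, Ex_const_mul, Ex_const hP]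
  ring

lemma Ex_avg_sub_sq_le {P : T → ℝ} (hP : IsProb P) {m : ℕ} (hm : 0 < m) (G : T → ℝ) :
    Ex (powW P m) (fun s => (avg G s - Ex P G) ^ 2) ≤ (m : ℝ)⁻¹ * Ex P (fun t => G t ^ 2) := by
  have h := Ex_sub_sq (hP.powW m) (avg G)
  rw [Ex_avg hP hm] at h
  linarith [Ex_avg_sq_le hP hm G]

/-- Average of a symmetric kernel over all pairs of draws from two batches. -/
noncomputable def pairAvg {m : ℕ} (h : T → T → ℝ) (s : (Fin m → T) × (Fin m → T)) : ℝ :=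
  avg (fun u => avg (h u) s.2) s.1

lemma Ex_pairAvg {P : T → ℝ} (hP : IsProb P) {m : ℕ} (hm : 0 < m) (h : T → T → ℝ) :
    Ex (prodW (powW P m) (powW P m)) (pairAvg h) = Ex P fun u => Ex P (h u) := by
  rw [Ex_prodW]
  simp only [pairAvg]
  rw [Ex_comm]
  simp only [Ex_avg hP hm]
  rw [Ex_comm]
  simp only [Ex_avg hP hm]

/-- `Ex_avg_sq_le` is applied over the first batch with the second fixed, and then over the second.
By symmetry of the kernel the two linear terms coincide. Using two batches avoids diagonal pairs,
which keeps the average unbiased. -/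
lemma Ex_pairAvg_sub_sq_le {P : T → ℝ} (hP : IsProb P) {m : ℕ} (hm : 0 < m) (h : T → T → ℝ)
    (hsymm : ∀ u v, h u v = h v u) :
    Ex (prodW (powW P m) (powW P m)) (fun s => (pairAvg h s - Ex P fun u => Ex P (h u)) ^ 2) ≤
      2 * (m : ℝ)⁻¹ * (Ex P fun u => Ex P (h u) ^ 2) +
        (m : ℝ)⁻¹ ^ 2 * (Ex P fun u => Ex P fun v => h u v ^ 2) := by
  have hm0 : (0 : ℝ) ≤ (m : ℝ)⁻¹ := by positivity
  have hcomm : ∀ v : Fin m → T, Ex P (fun u => avg (h u) v) = avg (fun w => Ex P (h w)) v := by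
    intro v
    simp only [avg]
    rw [Ex_const_mul, Ex_sum]
    simp only [fun u i => hsymm u (v i)]
  have h1 : Ex (prodW (powW P m) (powW P m)) (fun s => pairAvg h s ^ 2) ≤
      (m : ℝ)⁻¹ * (Ex P fun u => (m : ℝ)⁻¹ * Ex P (fun v => h u v ^ 2) + Ex P (h u) ^ 2) +
        ((m : ℝ)⁻¹ * (Ex P fun u => Ex P (h u) ^ 2) + (Ex P fun u => Ex P (h u)) ^ 2) := by
    rw [Ex_prodW, Ex_comm]
    simp only [pairAvg]
    refine (Ex_mono (hP.powW m) fun v => Ex_avg_sq_le hP hm fun u => avg (h u) v).trans ?_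
    rw [Ex_add, Ex_const_mul, Ex_comm]
    simp only [hcomm]
    gcongr
    · exact Ex_mono hP fun u => Ex_avg_sq_le hP hm (h u)
    · exact Ex_avg_sq_le hP hm _
  have h2 := Ex_sub_sq ((hP.powW m).prodW (hP.powW m)) (pairAvg h)
  rw [Ex_pairAvg hP hm] at h2
  rw [Ex_add, Ex_const_mul] at h1
  linarith

end FiniteProbability

/-! ### Variance of weighted inner products of empirical means. -/

section WeightedInnerProduct

variable {U Z : Type*} [Fintype U] [Fintype Z]

/-- Kernel given by the `w`-weighted inner product of the feature vectors of two points. -/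
def innerKernel (w : Z → ℝ) (φ : U → Z → ℝ) (u v : U) : ℝ := ∑ z, w z * φ u z * φ v z

lemma Ex_innerKernel (P : U → ℝ) (w : Z → ℝ) (φ : U → Z → ℝ) (u : U) :
    Ex P (innerKernel w φ u) = ∑ z, w z * φ u z * Ex P (fun v => φ v z) := by
  unfold innerKernel
  rw [Ex_sum]
  simp only [Ex_const_mul]

lemma Ex_Ex_innerKernel (P : U → ℝ) (w : Z → ℝ) (φ : U → Z → ℝ) :
    (Ex P fun u => Ex P (innerKernel w φ u)) = ∑ z, w z * Ex P (fun v => φ v z) ^ 2 := by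
  simp only [Ex_innerKernel]
  rw [Ex_sum]
  refine Finset.sum_congr rfl fun z _ => ?_
  rw [Ex_mul_const, Ex_const_mul]
  ring

/-- The variance bound for the weighted inner product of two empirical feature means. -/
lemma Ex_pairAvg_innerKernel_sub_sq_le {P : U → ℝ} (hP : IsProb P) {m : ℕ} (hm : 0 < m)
    {w : Z → ℝ} (hw0 : ∀ z, 0 ≤ w z) (hw1 : ∀ z, w z ≤ 1) {φ : U → Z → ℝ} {k : ℝ}
    (hφ : ∀ u, ∑ z, |φ u z| ≤ k) {D G : Z → ℝ} (hD : ∀ z, Ex P (fun u => φ u z) = D z)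
    (hG : ∀ z, Ex P (fun u => |φ u z|) ≤ G z) {γ : ℝ} (hγ : 0 ≤ γ)
    (hGγ : ∑ z, w z * G z ^ 2 ≤ γ ^ 2) :
    Ex (prodW (powW P m) (powW P m))
        (fun s => (pairAvg (innerKernel w φ) s - ∑ z, w z * D z ^ 2) ^ 2) ≤
      2 * (m : ℝ)⁻¹ * (k * γ * ∑ z, w z * D z ^ 2) + (m : ℝ)⁻¹ ^ 2 * (k ^ 2 * γ ^ 2) := by
  have hm0 : (0 : ℝ) ≤ (m : ℝ)⁻¹ := by positivity
  have hG0 : ∀ z, 0 ≤ G z := fun z => (Ex_nonneg hP fun u => abs_nonneg _).trans (hG z)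
  have hk : 0 ≤ k := by
    by_contra hk
    have : Ex P (fun _ => (0 : ℝ)) ≤ Ex P fun _ => k := Ex_mono hP fun u =>
      (Finset.sum_nonneg fun z _ => abs_nonneg _).trans (hφ u)
    rw [Ex_const hP, Ex_const hP] at this
    exact hk this
  -- A pointwise bound from the sum bound: since `w ≤ 1`, (wG)² ≤ wG² ≤ γ².
  have hwG : ∀ z, w z * G z ≤ γ := by
    intro z
    have h1 : w z * G z ^ 2 ≤ γ ^ 2 :=
      (Finset.single_le_sum (f := fun z => w z * G z ^ 2)
        (fun z _ => mul_nonneg (hw0 z) (sq_nonneg _)) (Finset.mem_univ z)).trans hGγ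
    refine abs_le_of_sq_le_sq' (?_ : (w z * G z) ^ 2 ≤ γ ^ 2) hγ |>.2
    calc (w z * G z) ^ 2 = w z * (w z * G z ^ 2) := by ring
      _ ≤ 1 * (w z * G z ^ 2) := by
        gcongr
        · exact mul_nonneg (hw0 z) (sq_nonneg _)
        · exact hw1 z
      _ ≤ γ ^ 2 := by rwa [one_mul]
  have hmain := Ex_pairAvg_sub_sq_le hP hm (innerKernel w φ) fun u v =>
    Finset.sum_congr rfl fun z _ => by ring
  rw [Ex_Ex_innerKernel] at hmain
  simp only [hD] at hmain
  refine hmain.trans ?_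
  gcongr
  -- Linear term: Cauchy–Schwarz with weights |φ u z| costs a factor `k`. Averaging over `u` turns
  -- |φ| into `G`, and `hwG` absorbs one factor wG.
  · have h1 : ∀ u, Ex P (innerKernel w φ u) ^ 2 ≤ k * ∑ z, |φ u z| * (w z * D z) ^ 2 := by
      intro u
      rw [Ex_innerKernel]
      simp only [hD]
      calc _ ≤ (∑ z, |φ u z|) * ∑ z, |φ u z| * (w z * D z) ^ 2 :=
            Finset.sum_sq_le_sum_mul_sum_of_sq_le_mul _ (fun _ _ => abs_nonneg _)
              (fun _ _ => by positivity) fun z _ => by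
                rw [← mul_assoc, abs_mul_abs_self]
                exact le_of_eq (by ring)
        _ ≤ _ := by
          gcongr
          exact hφ u
    refine (Ex_mono hP h1).trans ?_
    rw [Ex_const_mul, Ex_sum, mul_assoc]
    gcongr
    rw [Finset.mul_sum]
    refine Finset.sum_le_sum fun z _ => ?_
    rw [Ex_mul_const]
    calc _ ≤ G z * (w z * D z) ^ 2 := by gcongr; exact hG z
      _ = (w z * G z) * (w z * D z ^ 2) := by ring
      _ ≤ _ := by
        gcongr
        · exact mul_nonneg (hw0 z) (sq_nonneg _)
        · exact hwG z
  -- Quadratic term: Cauchy–Schwarz again, now with weights |φ u z||φ v z|. By independence of `u`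
  -- and `v`, averaging leaves ∑ wG².
  · have h1 : ∀ u v, innerKernel w φ u v ^ 2 ≤ k ^ 2 * ∑ z, w z * (|φ u z| * |φ v z|) := by
      intro u v
      have h2 : ∑ z, |φ u z| * |φ v z| ≤ k ^ 2 := by
        calc ∑ z, |φ u z| * |φ v z| ≤ ∑ z, |φ u z| * k := by
              gcongr with z
              exact (Finset.single_le_sum (f := fun z => |φ v z|) (fun _ _ => abs_nonneg _)
                (Finset.mem_univ z)).trans (hφ v)
          _ = (∑ z, |φ u z|) * k := by rw [Finset.sum_mul]
          _ ≤ k * k := by gcongr; exact hφ u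
          _ = k ^ 2 := by ring
      calc _ ≤ (∑ z, |φ u z| * |φ v z|) * ∑ z, w z * (|φ u z| * |φ v z|) :=
            Finset.sum_sq_le_sum_mul_sum_of_sq_le_mul _ (fun _ _ => by positivity)
              (fun z _ => mul_nonneg (hw0 z) (by positivity)) fun z _ => by
                calc (w z * φ u z * φ v z) ^ 2 = w z * (w z * (φ u z ^ 2 * φ v z ^ 2)) := by ring
                  _ ≤ 1 * (w z * (φ u z ^ 2 * φ v z ^ 2)) := by
                    gcongr
                    · exact mul_nonneg (hw0 z) (by positivity)
                    · exact hw1 z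
                  _ = _ := by
                    rw [← sq_abs (φ u z), ← sq_abs (φ v z)]
                    ring
        _ ≤ _ := by
          gcongr
          exact Finset.sum_nonneg fun z _ => mul_nonneg (hw0 z) (by positivity)
    refine (Ex_mono hP fun u => Ex_mono hP (h1 u)).trans ?_
    simp only [Ex_const_mul, Ex_sum, Ex_mul_const]
    gcongr
    refine le_trans (Finset.sum_le_sum fun z _ => ?_) hGγ
    have := hG z
    have h0 : 0 ≤ Ex P (fun u => |φ u z|) := Ex_nonneg hP fun u => abs_nonneg _
    rw [sq]
    exact mul_le_mul_of_nonneg_left (mul_le_mul this this h0 (hG0 z)) (hw0 z)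

end WeightedInnerProduct

/-! ### Flattening a marginal by a prediction and samples. -/

section Flattening

variable {T Y : Type*} [DecidableEq Y]

/-- The weights of the image of `P` under `π`. -/
def marg [Fintype T] (P : T → ℝ) (π : T → Y) (y : Y) : ℝ := Ex P fun t => if π t = y then 1 else 0

/-- Empirical frequency of `y` among the images under `π` of the sample `s`. -/
noncomputable def freq {m : ℕ} (π : T → Y) (s : Fin m → T) (y : Y) : ℝ :=
  avg (fun t => if π t = y then 1 else 0) s

/-- The (fractional) number of buckets into which `y` is split, for a prediction `r` and a
sample `s`. -/
noncomputable def buckets [Fintype Y] {m : ℕ} (r : Y → ℝ) (π : T → Y) (s : Fin m → T) (y : Y) : ℝ :=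
  1 + Fintype.card Y * r y + Fintype.card Y * freq π s y

lemma sum_marg_mul [Fintype T] [Fintype Y] (P : T → ℝ) (π : T → Y) (F : Y → ℝ) :
    ∑ y, marg P π y * F y = Ex P fun t => F (π t) := by
  simp only [marg, ← Ex_mul_const]
  rw [← Ex_sum]
  simp

lemma IsProb.marg [Fintype T] [Fintype Y] {P : T → ℝ} (hP : IsProb P) (π : T → Y) : IsProb (marg P π) where
  nonneg y := Ex_nonneg hP fun t => by split_ifs <;> norm_num
  sum_eq_one := by simpa [Ex_const hP] using sum_marg_mul P π fun _ => 1

lemma freq_nonneg {m : ℕ} (π : T → Y) (s : Fin m → T) (y : Y) : 0 ≤ freq π s y :=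
  mul_nonneg (by positivity) (Finset.sum_nonneg fun i _ => by dsimp only; split_ifs <;> norm_num)

lemma sum_freq [Fintype Y] {m : ℕ} (hm : 0 < m) (π : T → Y) (s : Fin m → T) : ∑ y, freq π s y = 1 := by
  have : (m : ℝ) ≠ 0 := by positivity
  simp only [freq, avg, ← Finset.mul_sum]
  rw [Finset.sum_comm]
  simp [this]

lemma one_le_buckets [Fintype Y] {m : ℕ} {r : Y → ℝ} (hr : ∀ y, 0 ≤ r y) (π : T → Y) (s : Fin m → T) (y : Y) :
    1 ≤ buckets r π s y := by
  have := mul_nonneg (Nat.cast_nonneg (α := ℝ) (Fintype.card Y)) (hr y)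
  have := mul_nonneg (Nat.cast_nonneg (α := ℝ) (Fintype.card Y)) (freq_nonneg π s y)
  unfold buckets
  linarith

lemma sum_buckets [Fintype Y] {m : ℕ} (hm : 0 < m) {r : Y → ℝ} (hr : IsProb r) (π : T → Y) (s : Fin m → T) :
    ∑ y, buckets r π s y = 3 * Fintype.card Y := by
  simp only [buckets, Finset.sum_add_distrib, ← Finset.mul_sum, hr.sum_eq_one, sum_freq hm]
  simp
  ring

/-- A symmetrization bound: the number of occurrences of `y` among `m` draws is rarely small. -/
lemma marg_mul_Ex_inv_count_le [Fintype T] {P : T → ℝ} (hP : IsProb P) (m : ℕ) (π : T → Y) (y : Y) :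
    marg P π y * Ex (powW P m) (fun s => (1 + ∑ i, if π (s i) = y then (1 : ℝ) else 0)⁻¹) ≤
      ((m : ℝ) + 1)⁻¹ := by
  -- Among `m + 1` exchangeable draws, each draw that hits `y` receives the share 1/(number of
  -- hits). All draws have the same expected share, and the shares sum to at most 1; with no hit the
  -- sum is 0, as 0⁻¹ = 0.
  have h1 : ∀ j : Fin (m + 1), Ex (powW P (m + 1)) (fun t => (if π (t j) = y then (1 : ℝ) else 0) *
      (∑ i, if π (t i) = y then (1 : ℝ) else 0)⁻¹) =
      marg P π y *
        Ex (powW P m) (fun s => (1 + ∑ i, if π (s i) = y then (1 : ℝ) else 0)⁻¹) := by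
    intro j
    rw [Ex_powW_insertNth P m j, marg, ← Ex_mul_const]
    refine congrArg (Ex P) (funext fun a => ?_)
    rw [← Ex_const_mul]
    refine congrArg (Ex _) (funext fun s => ?_)
    rw [Fin.sum_univ_succAbove _ j]
    simp only [Fin.insertNth_apply_same, Fin.insertNth_apply_succAbove]
    split_ifs <;> simp
  have h2 : Ex (powW P (m + 1)) (fun t => ∑ j, (if π (t j) = y then (1 : ℝ) else 0) *
      (∑ i, if π (t i) = y then (1 : ℝ) else 0)⁻¹) ≤ 1 := by
    refine (Ex_mono (hP.powW _) fun t => ?_).trans_eq (Ex_const (hP.powW (m + 1)) 1)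
    rw [← Finset.sum_mul]
    exact mul_inv_le_one
  rw [Ex_sum] at h2
  simp only [h1] at h2
  rw [Finset.sum_const, Finset.card_univ, Fintype.card_fin, nsmul_eq_mul] at h2
  push_cast at h2
  rw [← one_div, le_div_iff₀ (by positivity)]
  linarith

/-- Only the sample part of the buckets matters here. With c = |Y| and K hits, (1 + cK/m)(1 + m/c) ≥
1 + K. -/
lemma inv_buckets_le [Fintype Y] {m : ℕ} (hm : 0 < m) [Nonempty Y] {r : Y → ℝ} (hr : ∀ y, 0 ≤ r y)
    (π : T → Y) (s : Fin m → T) (y : Y) :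
    (buckets r π s y)⁻¹ ≤ (1 + (m : ℝ) / Fintype.card Y) *
      (1 + ∑ i, if π (s i) = y then (1 : ℝ) else 0)⁻¹ := by
  have hc : (0 : ℝ) < Fintype.card Y := by exact_mod_cast Fintype.card_pos
  have hm' : (0 : ℝ) < m := by exact_mod_cast hm
  have hb := one_le_buckets hr π s y
  have hN : 0 ≤ ∑ i, if π (s i) = y then (1 : ℝ) else 0 :=
    Finset.sum_nonneg fun i _ => by split_ifs <;> norm_num
  rw [← div_eq_mul_inv, inv_le_comm₀ (by positivity) (by positivity), inv_div,
    div_le_iff₀ (by positivity)]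
  unfold buckets freq avg
  set N := ∑ i, if π (s i) = y then (1 : ℝ) else 0
  set c : ℝ := (Fintype.card Y : ℝ)
  have h0 : 0 ≤ c * r y := mul_nonneg hc.le (hr y)
  have h1 : (1 + c * r y + c * ((m : ℝ)⁻¹ * N)) * (1 + m / c) =
      1 + N + (m / c + c * r y * (1 + m / c) + c * (m : ℝ)⁻¹ * N) := by
    field_simp
    ring
  rw [h1]
  have : 0 ≤ m / c + c * r y * (1 + m / c) + c * (m : ℝ)⁻¹ * N := by positivity
  linarith

/-- Flattening with a prediction that misses mass at most `α` makes the marginal nearly as flat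
as the uniform distribution. -/
lemma Ex_flattened_norm_le [Fintype T] [Fintype Y] {P : T → ℝ} (hP : IsProb P) {m : ℕ} (hm : 0 < m) [Nonempty Y]
    {r : Y → ℝ} (hr : ∀ y, 0 ≤ r y) (π : T → Y) {α : ℝ}
    (hα : ∑ y, max (marg P π y - r y) 0 ≤ α) :
    Ex (powW P m) (fun s => ∑ y, (buckets r π s y)⁻¹ * marg P π y ^ 2) ≤
      (Fintype.card Y : ℝ)⁻¹ + α * ((m : ℝ)⁻¹ + (Fintype.card Y : ℝ)⁻¹) := by
  have hc : (0 : ℝ) < Fintype.card Y := by exact_mod_cast Fintype.card_pos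
  have hm' : (0 : ℝ) < m := by exact_mod_cast hm
  have hp := hP.marg π
  -- One factor of the marginal is split as prediction plus excess. The predicted part is flattened
  -- to 1/|Y| by the prediction buckets; only the excess, of total mass at most `α`, relies on the
  -- sample buckets.
  have h1 : ∀ s : Fin m → T, ∀ y, (buckets r π s y)⁻¹ * marg P π y ^ 2 ≤
      marg P π y * (Fintype.card Y : ℝ)⁻¹ +
        max (marg P π y - r y) 0 * (1 + (m : ℝ) / Fintype.card Y) *
          (marg P π y * (1 + ∑ i, if π (s i) = y then (1 : ℝ) else 0)⁻¹) := by
    intro s y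
    have hb := one_le_buckets hr π s y
    have hb0 : 0 ≤ (buckets r π s y)⁻¹ := by positivity
    have hrb : r y * (buckets r π s y)⁻¹ ≤ (Fintype.card Y : ℝ)⁻¹ := by
      rw [← div_eq_mul_inv, div_le_iff₀ (by positivity), ← div_eq_inv_mul, le_div_iff₀ hc]
      have := mul_nonneg hc.le (freq_nonneg π s y)
      unfold buckets
      linarith
    have hple : marg P π y ≤ r y + max (marg P π y - r y) 0 := by
      linarith [le_max_left (marg P π y - r y) 0]
    have hp0 := hp.nonneg y
    calc (buckets r π s y)⁻¹ * marg P π y ^ 2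
        = marg P π y * (buckets r π s y)⁻¹ * marg P π y := by ring
      _ ≤ marg P π y * (buckets r π s y)⁻¹ * (r y + max (marg P π y - r y) 0) := by gcongr
      _ = marg P π y * (r y * (buckets r π s y)⁻¹) +
          max (marg P π y - r y) 0 * (marg P π y * (buckets r π s y)⁻¹) := by ring
      _ ≤ marg P π y * (Fintype.card Y : ℝ)⁻¹ + max (marg P π y - r y) 0 *
          (marg P π y * ((1 + (m : ℝ) / Fintype.card Y) *
            (1 + ∑ i, if π (s i) = y then (1 : ℝ) else 0)⁻¹)) := by
        gcongr
        exact inv_buckets_le hm hr π s y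
      _ = _ := by ring
  refine (Ex_mono (hP.powW m) fun s => Finset.sum_le_sum fun y _ => h1 s y).trans ?_
  rw [Ex_sum]
  have h2 : ∀ y, Ex (powW P m) (fun s => marg P π y * (Fintype.card Y : ℝ)⁻¹ +
        max (marg P π y - r y) 0 * (1 + (m : ℝ) / Fintype.card Y) *
          (marg P π y * (1 + ∑ i, if π (s i) = y then (1 : ℝ) else 0)⁻¹)) ≤
      marg P π y * (Fintype.card Y : ℝ)⁻¹ +
        max (marg P π y - r y) 0 * ((m : ℝ)⁻¹ + (Fintype.card Y : ℝ)⁻¹) := by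
    intro y
    rw [Ex_add, Ex_const (hP.powW m), Ex_const_mul, Ex_const_mul, mul_assoc]
    gcongr
    calc _ ≤ (1 + (m : ℝ) / Fintype.card Y) * (m : ℝ)⁻¹ := by
          gcongr
          refine (marg_mul_Ex_inv_count_le hP m π y).trans ?_
          gcongr
          linarith
      _ = _ := by field_simp
  refine (Finset.sum_le_sum fun y _ => h2 y).trans ?_
  rw [Finset.sum_add_distrib, ← Finset.sum_mul, ← Finset.sum_mul, hp.sum_eq_one, one_mul]
  gcongr

/-- Learning a marginal in total variation from its empirical frequencies. -/
lemma Pr_freq_far_le [Fintype T] [Fintype Y] {P : T → ℝ} (hP : IsProb P) {m : ℕ} (hm : 0 < m) (π : T → Y) {c η : ℝ}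
    (hc : 0 < c) (h : (Fintype.card Y : ℝ) ≤ η * (m * c ^ 2)) :
    Pr (powW P m) (fun s => c ≤ ∑ y, |freq π s y - marg P π y|) ≤ η := by
  have hm' : (0 : ℝ) < m := by exact_mod_cast hm
  have h1 : Ex (powW P m) (fun s => (∑ y, |freq π s y - marg P π y|) ^ 2) ≤ η * c ^ 2 := by
    calc _ ≤ Ex (powW P m) (fun s => Fintype.card Y * ∑ y, (freq π s y - marg P π y) ^ 2) := by
          refine Ex_mono (hP.powW m) fun s => ?_
          have := sq_sum_le_card_mul_sum_sq (s := Finset.univ)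
            (f := fun y => |freq π s y - marg P π y|)
          simpa using this
      _ = Fintype.card Y * ∑ y, Ex (powW P m) (fun s => (freq π s y - marg P π y) ^ 2) := by
          rw [Ex_const_mul, Ex_sum]
      _ ≤ Fintype.card Y * ∑ y, (m : ℝ)⁻¹ * marg P π y := by
          gcongr with y
          refine (Ex_avg_sub_sq_le hP hm fun t => if π t = y then (1 : ℝ) else 0).trans_eq ?_
          simp [marg]
      _ = Fintype.card Y * (m : ℝ)⁻¹ := by
          rw [← Finset.mul_sum, (hP.marg π).sum_eq_one, mul_one]
      _ ≤ η * (m * c ^ 2) * (m : ℝ)⁻¹ := by gcongr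
      _ = _ := by field_simp
  refine (Pr_mono (hP.powW m) fun s hs => ?_).trans
    (Pr_le_of_Ex_le (hP.powW m) (fun s => sq_nonneg _) (pow_pos hc 2) h1)
  exact pow_le_pow_left₀ hc.le hs 2

end Flattening

/-! ### Distance and norm statistics on a product of three blocks. -/

section ThreeBlocks

set_option linter.unusedSectionVars false

variable {X Y W : Type*} [Fintype X] [Fintype Y] [Fintype W]
  [DecidableEq X] [DecidableEq Y] [DecidableEq W]

/-- The product of the three marginals of `P`. -/
def indepW (P : X × Y × W → ℝ) (z : X × Y × W) : ℝ :=
  marg P (fun t => t.1) z.1 * marg P (fun t => t.2.1) z.2.1 * marg P (fun t => t.2.2) z.2.2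

/-- Weights of four independent draws from `P`. -/
def quadW {T : Type*} (P : T → ℝ) : T × T × T × T → ℝ := prodW P (prodW P (prodW P P))

lemma IsProb.quadW {T : Type*} [Fintype T] {P : T → ℝ} (hP : IsProb P) : IsProb (quadW P) :=
  hP.prodW (hP.prodW (hP.prodW hP))

/-- A draw from the product of the marginals, assembled from the last three of four draws. -/
def recombine (u : (X × Y × W) × (X × Y × W) × (X × Y × W) × (X × Y × W)) : X × Y × W :=
  (u.2.1.1, u.2.2.1.2.1, u.2.2.2.2.2)

/-- Difference of the point mass at the first draw and that at the recombined draw. -/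
def diffFeature (u : (X × Y × W) × (X × Y × W) × (X × Y × W) × (X × Y × W))
    (z : X × Y × W) : ℝ :=
  (if u.1 = z then 1 else 0) - (if recombine u = z then 1 else 0)

/-- Point mass at the middle block of the first draw. -/
def midFeature (u : (X × Y × W) × (X × Y × W) × (X × Y × W) × (X × Y × W)) (y : Y) : ℝ :=
  if u.1.2.1 = y then 1 else 0

lemma Ex_quadW_fst {T : Type*} [Fintype T] {P : T → ℝ} (hP : IsProb P) (F : T → ℝ) :
    Ex (quadW P) (fun u => F u.1) = Ex P F := by
  simp only [quadW, Ex_prodW, Ex_const hP]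

lemma Ex_quadW_mul {T : Type*} [Fintype T] {P : T → ℝ} (hP : IsProb P) (A B C : T → ℝ) :
    Ex (quadW P) (fun u => A u.2.1 * (B u.2.2.1 * C u.2.2.2)) = Ex P A * (Ex P B * Ex P C) := by
  simp only [quadW, Ex_prodW, Ex_const_mul, Ex_mul_const, Ex_const hP]

lemma Ex_point {T : Type*} [Fintype T] [DecidableEq T] (P : T → ℝ) (z : T) :
    Ex P (fun t => if t = z then 1 else 0) = P z := by
  simp [Ex]

lemma Ex_quadW_recombine {P : X × Y × W → ℝ} (hP : IsProb P) (z : X × Y × W) :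
    Ex (quadW P) (fun u => if recombine u = z then 1 else 0) = indepW P z := by
  have h : ∀ u : (X × Y × W) × (X × Y × W) × (X × Y × W) × (X × Y × W),
      (if recombine u = z then (1 : ℝ) else 0) =
        (if u.2.1.1 = z.1 then 1 else 0) *
          ((if u.2.2.1.2.1 = z.2.1 then 1 else 0) * (if u.2.2.2.2.2 = z.2.2 then 1 else 0)) := by
    intro u
    simp only [recombine, Prod.ext_iff, ← ite_and, mul_ite, mul_one, mul_zero]
    congr 1
    simp only [eq_iff_iff]
    tauto
  simp only [h]
  rw [Ex_quadW_mul hP (fun t => if t.1 = z.1 then (1 : ℝ) else 0)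
    (fun t => if t.2.1 = z.2.1 then (1 : ℝ) else 0) (fun t => if t.2.2 = z.2.2 then (1 : ℝ) else 0)]
  simp only [indepW, marg, mul_assoc]

lemma Ex_diffFeature {P : X × Y × W → ℝ} (hP : IsProb P) (z : X × Y × W) :
    Ex (quadW P) (fun u => diffFeature u z) = P z - indepW P z := by
  simp only [diffFeature]
  rw [Ex_sub, Ex_quadW_recombine hP, Ex_quadW_fst hP fun t => if t = z then (1 : ℝ) else 0,
    Ex_point]

lemma abs_diffFeature_le (u : (X × Y × W) × (X × Y × W) × (X × Y × W) × (X × Y × W))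
    (z : X × Y × W) :
    |diffFeature u z| ≤ (if u.1 = z then 1 else 0) + (if recombine u = z then 1 else 0) := by
  unfold diffFeature
  split_ifs <;> norm_num

lemma Ex_abs_diffFeature_le {P : X × Y × W → ℝ} (hP : IsProb P) (z : X × Y × W) :
    Ex (quadW P) (fun u => |diffFeature u z|) ≤ P z + indepW P z := by
  refine (Ex_mono hP.quadW fun u => abs_diffFeature_le u z).trans_eq ?_
  rw [Ex_add, Ex_quadW_recombine hP, Ex_quadW_fst hP fun t => if t = z then (1 : ℝ) else 0,
    Ex_point]

lemma sum_abs_diffFeature_le (u : (X × Y × W) × (X × Y × W) × (X × Y × W) × (X × Y × W)) :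
    ∑ z, |diffFeature u z| ≤ 2 := by
  refine (Finset.sum_le_sum fun z _ => abs_diffFeature_le u z).trans_eq ?_
  rw [Finset.sum_add_distrib, Finset.sum_ite_eq, Finset.sum_ite_eq]
  norm_num

/-- If `P` is the product of its marginals, the distance statistic is small. -/
lemma Pr_distance_large_le {P : X × Y × W → ℝ} (hP : IsProb P) (hind : P = indepW P) {m : ℕ}
    (hm : 0 < m) {w : X × Y × W → ℝ} (hw0 : ∀ z, 0 ≤ w z) (hw1 : ∀ z, w z ≤ 1) {τ : ℝ}
    (hτ : 0 < τ) (hQ : ∑ z, w z * indepW P z ^ 2 ≤ (m * τ / 10000) ^ 2) :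
    Pr (prodW (powW (quadW P) m) (powW (quadW P) m))
      (fun s => τ ≤ pairAvg (innerKernel w diffFeature) s) ≤ 1 / 200 := by
  have hm' : (0 : ℝ) < m := by exact_mod_cast hm
  -- Here S = 0, so the linear variance term vanishes. As P + Q = 2Q, γ is twice the assumed bound
  -- on the weighted norm of Q.
  have h := Ex_pairAvg_innerKernel_sub_sq_le hP.quadW hm hw0 hw1 (φ := diffFeature)
    sum_abs_diffFeature_le (Ex_diffFeature hP) (Ex_abs_diffFeature_le hP)
    (γ := 2 * (m * τ / 10000)) (by positivity) (by
      have h2 : ∀ z, w z * (P z + indepW P z) ^ 2 = 4 * (w z * indepW P z ^ 2) := by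
        intro z
        rw [← hind]
        ring
      simp only [h2, ← Finset.mul_sum]
      linarith)
  have h0 : ∑ z, w z * (P z - indepW P z) ^ 2 = 0 := by
    refine Finset.sum_eq_zero fun z _ => ?_
    rw [← hind]
    ring
  rw [h0] at h
  refine (Pr_mono ((hP.quadW.powW m).prodW (hP.quadW.powW m)) fun s hs => ?_).trans
    (Pr_abs_sub_le ((hP.quadW.powW m).prodW (hP.quadW.powW m)) hτ (h.trans ?_))
  · rw [sub_zero]
    exact hs.trans (le_abs_self _)
  · have : 2 * (m : ℝ)⁻¹ * (2 * (2 * (m * τ / 10000)) * 0) +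
        (m : ℝ)⁻¹ ^ 2 * (2 ^ 2 * (2 * (m * τ / 10000)) ^ 2) = 16 / 10000 ^ 2 * τ ^ 2 := by
      field_simp
      ring
    rw [this]
    nlinarith [sq_nonneg τ]

/-- If `P` is far from the product of its marginals, the distance statistic is large. -/
lemma Pr_distance_small_le {P : X × Y × W → ℝ} (hP : IsProb P) {m : ℕ}
    (hm : 0 < m) {w : X × Y × W → ℝ} (hw0 : ∀ z, 0 ≤ w z) (hw1 : ∀ z, w z ≤ 1) {τ : ℝ}
    (hτ : 0 < τ) (hQ : ∑ z, w z * indepW P z ^ 2 ≤ (m * τ / 10000) ^ 2)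
    (hS : 2 * τ ≤ ∑ z, w z * (P z - indepW P z) ^ 2)
    (hmS : 1 ≤ (m / 10000) ^ 2 * ∑ z, w z * (P z - indepW P z) ^ 2) :
    Pr (prodW (powW (quadW P) m) (powW (quadW P) m))
      (fun s => pairAvg (innerKernel w diffFeature) s < τ) ≤ 1 / 200 := by
  have hm' : (0 : ℝ) < m := by exact_mod_cast hm
  set S := ∑ z, w z * (P z - indepW P z) ^ 2 with hSdef
  have hS0 : 0 < S := by linarith
  -- γ is taken proportional to S rather than τ, so both variance terms become multiples of S² and
  -- Chebyshev at S/2 applies.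
  have h := Ex_pairAvg_innerKernel_sub_sq_le hP.quadW hm hw0 hw1 (φ := diffFeature)
    sum_abs_diffFeature_le (Ex_diffFeature hP) (Ex_abs_diffFeature_le hP)
    (γ := 2 * (m * S / 10000)) (by positivity) (by
      have h2 : ∀ z, w z * (P z + indepW P z) ^ 2 ≤
          8 * (w z * indepW P z ^ 2) + 2 * (w z * (P z - indepW P z) ^ 2) := by
        intro z
        -- The difference of the two sides is (P − 3Q)².
        have : (P z + indepW P z) ^ 2 ≤ 8 * indepW P z ^ 2 + 2 * (P z - indepW P z) ^ 2 := by
          nlinarith [sq_nonneg (P z - 3 * indepW P z)]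
        nlinarith [mul_le_mul_of_nonneg_left this (hw0 z)]
      refine (Finset.sum_le_sum fun z _ => h2 z).trans ?_
      rw [Finset.sum_add_distrib, ← Finset.mul_sum, ← Finset.mul_sum, ← hSdef]
      have h3 : (m * τ / 10000) ^ 2 ≤ (m * (S / 2) / 10000) ^ 2 := by
        gcongr
        linarith
      have h4 : S ≤ (m * S / 10000) ^ 2 := by
        calc S = 1 * S := by ring
          _ ≤ ((m / 10000) ^ 2 * S) * S := by gcongr
          _ = _ := by ring
      nlinarith)
  refine (Pr_mono ((hP.quadW.powW m).prodW (hP.quadW.powW m)) fun s hs => ?_).trans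
    (Pr_abs_sub_le ((hP.quadW.powW m).prodW (hP.quadW.powW m)) (c := S / 2) (by positivity)
      (h.trans ?_))
  · rw [← hSdef, abs_sub_comm]
    refine le_trans ?_ (le_abs_self _)
    linarith
  · rw [← hSdef]
    have : 2 * (m : ℝ)⁻¹ * (2 * (2 * (m * S / 10000)) * S) +
        (m : ℝ)⁻¹ ^ 2 * (2 ^ 2 * (2 * (m * S / 10000)) ^ 2) =
          (8 / 10000 + 16 / 10000 ^ 2) * S ^ 2 := by
      field_simp
      ring
    rw [this]
    nlinarith [sq_nonneg S]

lemma Ex_midFeature {P : X × Y × W → ℝ} (hP : IsProb P) (y : Y) :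
    Ex (quadW P) (fun u => midFeature u y) = marg P (fun t => t.2.1) y :=
  Ex_quadW_fst hP fun t => if t.2.1 = y then (1 : ℝ) else 0

lemma midFeature_nonneg (u : (X × Y × W) × (X × Y × W) × (X × Y × W) × (X × Y × W)) (y : Y) :
    0 ≤ midFeature u y := by
  unfold midFeature
  split_ifs <;> norm_num

/-- The norm statistic does not underestimate the flattened norm by much. -/
lemma Pr_norm_small_le {P : X × Y × W → ℝ} (hP : IsProb P) {m : ℕ}
    (hm : 0 < m) {w : Y → ℝ} (hw0 : ∀ z, 0 ≤ w z) (hw1 : ∀ z, w z ≤ 1) {q : ℝ} (hq : 0 < q)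
    (hQ : 2 * q ≤ ∑ y, w y * marg P (fun t => t.2.1) y ^ 2)
    (hmq : 1 ≤ (m / 10000) ^ 2 * q) :
    Pr (prodW (powW (quadW P) m) (powW (quadW P) m))
      (fun s => pairAvg (innerKernel w midFeature) s < q) ≤ 1 / 200 := by
  have hm' : (0 : ℝ) < m := by exact_mod_cast hm
  set Q := ∑ y, w y * marg P (fun t => t.2.1) y ^ 2 with hQdef
  have hQ0 : 0 < Q := by linarith
  -- The feature is nonnegative, so its mean serves as both `D` and `G`. The requirement Q ≤ γ²
  -- becomes 1 ≤ (m/10000)²Q.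
  have h := Ex_pairAvg_innerKernel_sub_sq_le hP.quadW hm hw0 hw1 (φ := midFeature) (k := 1)
    (fun u => by
      simp only [abs_of_nonneg (midFeature_nonneg u _)]
      simp [midFeature]) (Ex_midFeature hP)
    (G := marg P (fun t => t.2.1)) (fun y => by
      simp only [abs_of_nonneg (midFeature_nonneg _ y)]
      exact (Ex_midFeature hP y).le)
    (γ := m * Q / 10000) (by positivity) (by
      rw [← hQdef]
      calc Q = 1 * Q := by ring
        _ ≤ ((m / 10000) ^ 2 * Q) * Q := by
          gcongr
          refine hmq.trans ?_
          gcongr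
          linarith
        _ = _ := by ring)
  refine (Pr_mono ((hP.quadW.powW m).prodW (hP.quadW.powW m)) fun s hs => ?_).trans
    (Pr_abs_sub_le ((hP.quadW.powW m).prodW (hP.quadW.powW m)) (c := Q / 2) (by positivity)
      (h.trans ?_))
  · rw [← hQdef, abs_sub_comm]
    refine le_trans ?_ (le_abs_self _)
    linarith
  · rw [← hQdef]
    have : 2 * (m : ℝ)⁻¹ * (1 * (m * Q / 10000) * Q) +
        (m : ℝ)⁻¹ ^ 2 * (1 ^ 2 * (m * Q / 10000) ^ 2) =
          (2 / 10000 + 1 / 10000 ^ 2) * Q ^ 2 := by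
      field_simp
    rw [this]
    nlinarith [sq_nonneg Q]

lemma Ex_norm {P : X × Y × W → ℝ} (hP : IsProb P) {m : ℕ} (hm : 0 < m) (w : Y → ℝ) :
    Ex (prodW (powW (quadW P) m) (powW (quadW P) m)) (pairAvg (innerKernel w midFeature)) =
      ∑ y, w y * marg P (fun t => t.2.1) y ^ 2 := by
  rw [Ex_pairAvg hP.quadW hm, Ex_Ex_innerKernel]
  simp only [Ex_midFeature hP]

end ThreeBlocks

/-! ### The three-block tester and its parameter regime. -/

section BlockTester

set_option linter.unusedSectionVars false

variable {X Y W : Type*} [Fintype X] [Fintype Y] [Fintype W]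
  [DecidableEq X] [DecidableEq Y] [DecidableEq W]

/-- The number of buckets of a point of the product: the product over the three blocks. -/
noncomputable def blockBuckets {m : ℕ} (r : X × Y × W → ℝ) (s : Fin m → X × Y × W)
    (z : X × Y × W) : ℝ :=
  buckets (marg r fun t => t.1) (fun t => t.1) s z.1 *
    buckets (marg r fun t => t.2.1) (fun t => t.2.1) s z.2.1 *
    buckets (marg r fun t => t.2.2) (fun t => t.2.2) s z.2.2

/-- Squared norm of the flattened marginal along `π`. -/
noncomputable def flatNorm {V : Type*} [Fintype V] [DecidableEq V] {m : ℕ} (P r : X × Y × W → ℝ)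
    (π : X × Y × W → V) (s : Fin m → X × Y × W) : ℝ :=
  ∑ y, (buckets (marg r π) π s y)⁻¹ * marg P π y ^ 2

/-- A bound for the expected squared norm of the flattened middle marginal. -/
noncomputable def normBound (Y : Type*) [Fintype Y] (m : ℕ) (α : ℝ) : ℝ :=
  2 / Fintype.card Y + α / m

/-- The threshold for the distance statistic. -/
noncomputable def distBound (X Y W : Type*) [Fintype X] [Fintype Y] [Fintype W] (ε : ℝ) : ℝ :=
  ε ^ 2 / (54 * (Fintype.card X * Fintype.card Y * Fintype.card W))

/-- The sample space of the tester: one batch for flattening and learning and two batches of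
quadruples for the norm and distance statistics. -/
abbrev Batches (m : ℕ) (T : Type*) : Type _ :=
  (Fin m → T) × ((Fin m → T × T × T × T) × (Fin m → T × T × T × T))

/-- Weights of the batches for independent draws from `P`. -/
def batchW {T : Type*} (m : ℕ) (P : T → ℝ) : Batches m T → ℝ :=
  prodW (powW P m) (prodW (powW (quadW P) m) (powW (quadW P) m))

lemma IsProb.batchW {T : Type*} [Fintype T] {P : T → ℝ} (hP : IsProb P) (m : ℕ) :
    IsProb (batchW m P) :=
  (hP.powW m).prodW ((hP.quadW.powW m).prodW (hP.quadW.powW m))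

/-- Estimate of the squared norm of the flattened middle marginal. -/
noncomputable def normStat {m : ℕ} (r : X × Y × W → ℝ) (t : Batches m (X × Y × W)) : ℝ :=
  pairAvg (innerKernel
    (fun y => (buckets (marg r fun t => t.2.1) (fun t => t.2.1) t.1 y)⁻¹) midFeature) t.2

/-- Estimate of the squared flattened distance from the product of the marginals. -/
noncomputable def distStat {m : ℕ} (r : X × Y × W → ℝ) (t : Batches m (X × Y × W)) : ℝ :=
  pairAvg (innerKernel (fun z => (blockBuckets r t.1 z)⁻¹) diffFeature) t.2

open Classical in
/-- The tester. The classes `𝒜` and `ℬ` contain the admissible marginals on the outer blocks. -/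
noncomputable def blockTester (m : ℕ) (α ε : ℝ) (𝒜 : Set (X → ℝ)) (ℬ : Set (W → ℝ))
    (r : X × Y × W → ℝ) (t : Batches m (X × Y × W)) : Answer :=
  if 20 * normBound Y m α ≤ normStat r t then Answer.inaccurateInformation
  else if distBound X Y W ε ≤ distStat r t ∨
      (¬ ∃ a ∈ 𝒜, ∑ x, |freq (fun t => t.1) t.1 x - a x| < ε / 4) ∨
      (¬ ∃ b ∈ ℬ, ∑ x, |freq (fun t => t.2.2) t.1 x - b x| < ε / 4) then Answer.reject
  else Answer.accept

/-- The parameter regime in which the block tester is analysed. -/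
structure EnoughSamples (X Y W : Type*) [Fintype X] [Fintype Y] [Fintype W] (m : ℕ) (α ε : ℝ) :
    Prop where
  eps_pos : 0 < ε
  eps_lt : ε < 1
  alpha_nonneg : 0 ≤ α
  alpha_le : α ≤ 1
  card_left : (Fintype.card X : ℝ) ^ 2 ≤ Fintype.card X * Fintype.card Y * Fintype.card W
  card_right : (Fintype.card W : ℝ) ^ 2 ≤ Fintype.card X * Fintype.card Y * Fintype.card W
  le_sq : 10 ^ 20 * ((Fintype.card X : ℝ) * Fintype.card Y * Fintype.card W) ≤ m ^ 2 * ε ^ 4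
  le_cube : 10 ^ 20 * (Fintype.card Y * ((Fintype.card X : ℝ) * Fintype.card Y * Fintype.card W) * α)
    ≤ m ^ 3 * ε ^ 4

variable [Nonempty X] [Nonempty Y] [Nonempty W] {m : ℕ} {α ε : ℝ}

lemma EnoughSamples.pos (h : EnoughSamples X Y W m α ε) : 0 < m := by
  have h1 := h.le_sq
  have hX : (0 : ℝ) < Fintype.card X := by exact_mod_cast Fintype.card_pos
  have hY : (0 : ℝ) < Fintype.card Y := by exact_mod_cast Fintype.card_pos
  have hW : (0 : ℝ) < Fintype.card W := by exact_mod_cast Fintype.card_pos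
  rcases Nat.eq_zero_or_pos m with rfl | hm
  · have : 0 < 10 ^ 20 * ((Fintype.card X : ℝ) * Fintype.card Y * Fintype.card W) := by positivity
    norm_num at h1 this
    linarith
  · exact hm

lemma EnoughSamples.le_mul_sq {n : ℝ} (h : EnoughSamples X Y W m α ε)
    (hn : n ^ 2 ≤ Fintype.card X * Fintype.card Y * Fintype.card W) :
    10 ^ 10 * n ≤ m * ε ^ 2 := by
  refine abs_le_of_sq_le_sq' (?_ : (10 ^ 10 * n) ^ 2 ≤ (m * ε ^ 2) ^ 2) (by positivity) |>.2
  calc (10 ^ 10 * n) ^ 2 = 10 ^ 20 * n ^ 2 := by ring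
    _ ≤ 10 ^ 20 * ((Fintype.card X : ℝ) * Fintype.card Y * Fintype.card W) := by gcongr
    _ ≤ m ^ 2 * ε ^ 4 := h.le_sq
    _ = _ := by ring

lemma EnoughSamples.le_of_sq_le {n : ℝ} (h : EnoughSamples X Y W m α ε)
    (hn : n ^ 2 ≤ Fintype.card X * Fintype.card Y * Fintype.card W) : n ≤ m := by
  have h1 := h.le_mul_sq hn
  have h2 : ε ^ 2 ≤ 1 := pow_le_one₀ h.eps_pos.le h.eps_lt.le
  have h3 : (m : ℝ) * ε ^ 2 ≤ m * 1 := by gcongr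
  rcases le_total n 0 with h0 | h0
  · exact h0.trans (by positivity)
  · linarith

lemma sum_max_sub_le {V : Type*} [Fintype V] {p r : V → ℝ} (hp : IsProb p) (hr : IsProb r) :
    ∑ y, max (p y - r y) 0 ≤ 1 := by
  rw [← hp.sum_eq_one]
  exact Finset.sum_le_sum fun y _ => max_le (by linarith [hr.nonneg y]) (hp.nonneg y)

/-- Both marginals have mass 1, so the positive part carries half the ℓ¹ distance, and pushing
forward does not increase that distance. -/
lemma sum_max_marg_sub_le {T V : Type*} [Fintype T] [Fintype V] [DecidableEq V] {P r : T → ℝ}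
    (hP : IsProb P) (hr : IsProb r) (π : T → V) (h : ∑ t, |P t - r t| ≤ 2 * α) :
    ∑ y, max (marg P π y - marg r π y) 0 ≤ α := by
  have h1 : ∀ y, max (marg P π y - marg r π y) 0 =
      (|marg P π y - marg r π y| + (marg P π y - marg r π y)) / 2 := by
    intro y
    rcases le_total 0 (marg P π y - marg r π y) with h | h
    · rw [max_eq_left h, abs_of_nonneg h]; ring
    · rw [max_eq_right h, abs_of_nonpos h]; ring
  simp only [h1]
  rw [← Finset.sum_div, Finset.sum_add_distrib, Finset.sum_sub_distrib,
    (hP.marg π).sum_eq_one, (hr.marg π).sum_eq_one]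
  have h2 : ∑ y, |marg P π y - marg r π y| ≤ ∑ t, |P t - r t| := by
    calc _ ≤ ∑ y, ∑ t, |P t - r t| * (if π t = y then 1 else 0) := by
          refine Finset.sum_le_sum fun y _ => ?_
          simp only [marg, Ex]
          rw [← Finset.sum_sub_distrib]
          refine (Finset.abs_sum_le_sum_abs _ _).trans (Finset.sum_le_sum fun t _ => ?_)
          rw [← sub_mul, abs_mul]
          gcongr
          split_ifs <;> norm_num
      _ = _ := by
          rw [Finset.sum_comm]
          simp
  linarith

lemma flatNorm_nonneg {V : Type*} [Fintype V] [DecidableEq V] {P r : X × Y × W → ℝ}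
    (hr : IsProb r) (π : X × Y × W → V) (s : Fin m → X × Y × W) : 0 ≤ flatNorm P r π s :=
  Finset.sum_nonneg fun y _ => mul_nonneg
    (inv_nonneg.2 (zero_le_one.trans (one_le_buckets (hr.marg π).nonneg π s y))) (sq_nonneg _)

/-- Weights and product of marginals both factor over the blocks, so each block can be flattened
separately. -/
lemma sum_inv_blockBuckets_mul (P r : X × Y × W → ℝ) (s : Fin m → X × Y × W) :
    ∑ z, (blockBuckets r s z)⁻¹ * indepW P z ^ 2 =
      flatNorm P r (fun t => t.1) s * flatNorm P r (fun t => t.2.1) s *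
        flatNorm P r (fun t => t.2.2) s := by
  have h : ∀ z : X × Y × W, (blockBuckets r s z)⁻¹ * indepW P z ^ 2 =
      (buckets (marg r fun t => t.1) (fun t => t.1) s z.1)⁻¹ * marg P (fun t => t.1) z.1 ^ 2 *
      ((buckets (marg r fun t => t.2.1) (fun t => t.2.1) s z.2.1)⁻¹ *
        marg P (fun t => t.2.1) z.2.1 ^ 2) *
      ((buckets (marg r fun t => t.2.2) (fun t => t.2.2) s z.2.2)⁻¹ *
        marg P (fun t => t.2.2) z.2.2 ^ 2) := by
    intro z
    rw [blockBuckets, indepW, mul_inv, mul_inv]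
    ring
  simp only [h, Fintype.sum_prod_type, ← Finset.mul_sum, ← Finset.sum_mul]
  rfl

lemma one_le_blockBuckets {r : X × Y × W → ℝ} (hr : IsProb r) (s : Fin m → X × Y × W)
    (z : X × Y × W) : 1 ≤ blockBuckets r s z :=
  one_le_mul_of_one_le_of_one_le (one_le_mul_of_one_le_of_one_le
    (one_le_buckets (hr.marg _).nonneg _ s _) (one_le_buckets (hr.marg _).nonneg _ s _))
    (one_le_buckets (hr.marg _).nonneg _ s _)

lemma sum_blockBuckets (hm : 0 < m) {r : X × Y × W → ℝ} (hr : IsProb r)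
    (s : Fin m → X × Y × W) :
    ∑ z, blockBuckets r s z = 27 * (Fintype.card X * Fintype.card Y * Fintype.card W) := by
  simp only [blockBuckets, Fintype.sum_prod_type, ← Finset.mul_sum, ← Finset.sum_mul,
    sum_buckets hm (hr.marg _)]
  ring

/-- The prediction may be arbitrary: the excess mass is trivially at most 1, and |V| ≤ m gives
expected norm at most 3/|V|. Markov then yields 600 = 3 · 200. -/
lemma EnoughSamples.Pr_flatNorm_outer_le {V : Type*} [Fintype V] [DecidableEq V] [Nonempty V]
    (h : EnoughSamples X Y W m α ε) {P r : X × Y × W → ℝ} (hP : IsProb P) (hr : IsProb r)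
    (π : X × Y × W → V)
    (hV : (Fintype.card V : ℝ) ^ 2 ≤ Fintype.card X * Fintype.card Y * Fintype.card W) :
    Pr (batchW m P) (fun t => 600 / Fintype.card V ≤ flatNorm P r π t.1) ≤ 1 / 200 := by
  have hc : (0 : ℝ) < Fintype.card V := by exact_mod_cast Fintype.card_pos
  have hm := h.pos
  have hm' : (0 : ℝ) < m := by exact_mod_cast hm
  rw [batchW, Pr_prodW_fst _ ((hP.quadW.powW m).prodW (hP.quadW.powW m))
    fun s => 600 / (Fintype.card V : ℝ) ≤ flatNorm P r π s]
  refine Pr_le_of_Ex_le (hP.powW m) (flatNorm_nonneg hr π) (by positivity)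
    ((Ex_flattened_norm_le hP hm (hr.marg π).nonneg π
      (sum_max_sub_le (hP.marg π) (hr.marg π))).trans ?_)
  have h1 : (m : ℝ)⁻¹ ≤ (Fintype.card V : ℝ)⁻¹ := inv_anti₀ hc (h.le_of_sq_le hV)
  rw [div_eq_mul_inv 600]
  linarith

lemma normBound_pos (hα : 0 ≤ α) : 0 < normBound Y m α := by
  have hY : (0 : ℝ) < Fintype.card Y := by exact_mod_cast Fintype.card_pos
  unfold normBound
  positivity

/-- The statistic is nonnegative with mean at most `normBound`, so Markov at 20 times that bound
gives exactly δ/2 = 1/20. -/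
lemma EnoughSamples.Pr_inaccurate_le (h : EnoughSamples X Y W m α ε) {P r : X × Y × W → ℝ}
    (hP : IsProb P) (hr : IsProb r) (hPr : ∑ z, |P z - r z| ≤ 2 * α) :
    Pr (batchW m P) (fun t => 20 * normBound Y m α ≤ normStat r t) ≤ 1 / 20 := by
  have hY : (0 : ℝ) < Fintype.card Y := by exact_mod_cast Fintype.card_pos
  have hm := h.pos
  have hm' : (0 : ℝ) < m := by exact_mod_cast hm
  have hpos := normBound_pos (Y := Y) (m := m) h.alpha_nonneg
  refine Pr_le_of_Ex_le (hP.batchW m) (fun t => ?_) (by positivity) ?_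
  · refine mul_nonneg (by positivity) (Finset.sum_nonneg fun i _ => mul_nonneg (by positivity)
      (Finset.sum_nonneg fun j _ => Finset.sum_nonneg fun y _ => ?_))
    exact mul_nonneg (mul_nonneg (inv_nonneg.2 (zero_le_one.trans
      (one_le_buckets (hr.marg _).nonneg _ _ y))) (midFeature_nonneg _ _)) (midFeature_nonneg _ _)
  · rw [batchW, Ex_prodW]
    simp only [normStat]
    simp only [Ex_norm hP hm]
    refine (Ex_flattened_norm_le hP hm (hr.marg _).nonneg _
      (sum_max_marg_sub_le hP hr _ hPr)).trans ?_
    have h1 : α * (Fintype.card Y : ℝ)⁻¹ ≤ 1 * (Fintype.card Y : ℝ)⁻¹ := by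
      gcongr
      exact h.alpha_le
    unfold normBound
    rw [div_eq_mul_inv 2, div_eq_mul_inv α]
    linarith

lemma one_le_card_real (V : Type*) [Fintype V] [Nonempty V] : (1 : ℝ) ≤ Fintype.card V := by
  exact_mod_cast Fintype.card_pos (α := V)

lemma EnoughSamples.card_mul_le (h : EnoughSamples X Y W m α ε) :
    10 ^ 20 * ((Fintype.card X : ℝ) * Fintype.card Y * Fintype.card W) ≤ m ^ 2 * ε ^ 2 := by
  refine h.le_sq.trans ?_
  gcongr 1
  exact pow_le_pow_of_le_one h.eps_pos.le h.eps_lt.le (by norm_num)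

/-- Passing the norm check certifies flatness of the middle marginal whatever the prediction is. The
flattening batch is fixed first, which makes the weights deterministic. -/
lemma EnoughSamples.Pr_norm_underestimated_le (h : EnoughSamples X Y W m α ε)
    {P r : X × Y × W → ℝ} (hP : IsProb P) (hr : IsProb r) :
    Pr (batchW m P) (fun t => normStat r t < 20 * normBound Y m α ∧
      40 * normBound Y m α ≤ flatNorm P r (fun t => t.2.1) t.1) ≤ 1 / 200 := by
  have hX := one_le_card_real X
  have hY := one_le_card_real Y
  have hW := one_le_card_real W
  have hm := h.pos
  have hm' : (0 : ℝ) < m := by exact_mod_cast hm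
  have hpos := normBound_pos (Y := Y) (m := m) h.alpha_nonneg
  have hpr := (hP.quadW.powW m).prodW (hP.quadW.powW m)
  refine Pr_prodW_le (hP.powW m) fun s => ?_
  by_cases hs : 40 * normBound Y m α ≤ flatNorm P r (fun t => t.2.1) s
  · refine (Pr_mono hpr fun t ht => ht.1).trans (Pr_norm_small_le hP hm
      (fun y => inv_nonneg.2 (zero_le_one.trans (one_le_buckets (hr.marg _).nonneg _ _ y)))
      (fun y => inv_le_one_of_one_le₀ (one_le_buckets (hr.marg _).nonneg _ _ y))
      (by positivity) ?_ ?_)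
    · unfold flatNorm at hs
      linarith
    · have h1 : 2 / (Fintype.card Y : ℝ) ≤ normBound Y m α := by
        have := div_nonneg h.alpha_nonneg hm'.le
        unfold normBound
        linarith
      have h2 : 10 ^ 20 * (Fintype.card Y : ℝ) ≤ m ^ 2 := by
        calc 10 ^ 20 * (Fintype.card Y : ℝ)
            = 10 ^ 20 * (1 * (Fintype.card Y : ℝ) * 1) := by ring
          _ ≤ 10 ^ 20 * (Fintype.card X * (Fintype.card Y : ℝ) * Fintype.card W) := by gcongr
          _ ≤ m ^ 2 * ε ^ 4 := h.le_sq
          _ ≤ m ^ 2 * 1 := by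
            gcongr
            exact pow_le_one₀ h.eps_pos.le h.eps_lt.le
          _ = _ := by ring
      calc (1 : ℝ) ≤ (m / 10000) ^ 2 * (20 * (2 / (Fintype.card Y : ℝ))) := by
            rw [show ((m : ℝ) / 10000) ^ 2 * (20 * (2 / (Fintype.card Y : ℝ))) =
              (m ^ 2 * 40 / 10 ^ 8) / Fintype.card Y by ring, one_le_div (by positivity)]
            linarith
        _ ≤ _ := by gcongr
  · refine (Pr_mono (E' := fun _ => (1 : ℝ) ≤ 0) hpr fun t ht => (hs ht.2).elim).trans
      (Pr_le_of_Ex_le hpr (fun _ => le_rfl) one_pos ?_)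
    rw [Ex_const hpr]
    norm_num

/-- The product of the flattened norms of the marginals is small compared with the threshold. -/
lemma EnoughSamples.norm_mul_le (h : EnoughSamples X Y W m α ε) {p q r : ℝ} (hq : 0 ≤ q)
    (hr : 0 ≤ r) (hp' : p < 600 / Fintype.card X) (hq' : q < 40 * normBound Y m α)
    (hr' : r < 600 / Fintype.card W) :
    p * q * r ≤ (m * distBound X Y W ε / 10000) ^ 2 := by
  have hX : (0 : ℝ) < Fintype.card X := by exact_mod_cast Fintype.card_pos
  have hY : (0 : ℝ) < Fintype.card Y := by exact_mod_cast Fintype.card_pos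
  have hW : (0 : ℝ) < Fintype.card W := by exact_mod_cast Fintype.card_pos
  have hm := h.pos
  have hm' : (0 : ℝ) < m := by exact_mod_cast hm
  have h1 := h.le_sq
  have h2 := h.le_cube
  have h0 := h.alpha_nonneg
  unfold normBound at hq'
  unfold distBound
  set a : ℝ := (Fintype.card X : ℝ)
  set c : ℝ := (Fintype.card Y : ℝ)
  set b : ℝ := (Fintype.card W : ℝ)
  have h3 : 10 ^ 20 * (c * (a * c * b) * α) / m ≤ m ^ 2 * ε ^ 4 := by
    rw [div_le_iff₀ hm']
    linarith
  -- Over the denominator (acb)² the two summands become acb and c(acb)α/m, which `le_sq` and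
  -- `le_cube` control respectively.
  calc p * q * r ≤ (600 / a) * (40 * (2 / c + α / m)) * (600 / b) := by gcongr
    _ = 14400000 / (a * c * b) ^ 2 * (2 * (a * c * b) + c * (a * c * b) * α / m) := by
      field_simp
      ring
    _ ≤ 14400000 / (a * c * b) ^ 2 * (3 / 10 ^ 20 * (m ^ 2 * ε ^ 4)) := by
      gcongr
      rw [mul_div_assoc] at h3
      linarith
    _ ≤ 1 / (54 ^ 2 * 10000 ^ 2) / (a * c * b) ^ 2 * (m ^ 2 * ε ^ 4) := by
      rw [← mul_assoc]
      gcongr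
      rw [div_mul_eq_mul_div]
      gcongr
      norm_num
    _ = _ := by
      field_simp

lemma distBound_pos (hε : 0 < ε) : 0 < distBound X Y W ε := by
  have hX : (0 : ℝ) < Fintype.card X := by exact_mod_cast Fintype.card_pos
  have hY : (0 : ℝ) < Fintype.card Y := by exact_mod_cast Fintype.card_pos
  have hW : (0 : ℝ) < Fintype.card W := by exact_mod_cast Fintype.card_pos
  unfold distBound
  positivity

/-- The flattened marginals are flat. -/
def FlatSample (m : ℕ) (α : ℝ) (P r : X × Y × W → ℝ) (s : Fin m → X × Y × W) : Prop :=
  flatNorm P r (fun t => t.1) s < 600 / Fintype.card X ∧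
    flatNorm P r (fun t => t.2.1) s < 40 * normBound Y m α ∧
    flatNorm P r (fun t => t.2.2) s < 600 / Fintype.card W

/-- Conditioning on the flattening batch: the Chebyshev bounds need only hold for fixed weights from
a good batch. -/
lemma Pr_and_of_fst_le {P : X × Y × W → ℝ} (hP : IsProb P) {E : (Fin m → X × Y × W) → Prop}
    {F : Batches m (X × Y × W) → Prop} {η : ℝ} (hη : 0 ≤ η)
    (h : ∀ s, E s →
      Pr (prodW (powW (quadW P) m) (powW (quadW P) m)) (fun t => F (s, t)) ≤ η) :
    Pr (batchW m P) (fun t => E t.1 ∧ F t) ≤ η := by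
  have hpr := (hP.quadW.powW m).prodW (hP.quadW.powW m)
  refine Pr_prodW_le (hP.powW m) fun s => ?_
  by_cases hs : E s
  · exact (Pr_mono hpr fun t ht => ht.2).trans (h s hs)
  · refine (Pr_mono (E' := fun _ => (1 : ℝ) ≤ 0) hpr fun t ht => (hs ht.1).elim).trans
      (Pr_le_of_Ex_le hpr (fun _ => le_rfl) one_pos ?_)
    rw [Ex_const hpr]
    linarith

lemma EnoughSamples.sum_inv_blockBuckets_le (h : EnoughSamples X Y W m α ε) {P r : X × Y × W → ℝ}
    (hr : IsProb r) {s : Fin m → X × Y × W} (hs : FlatSample m α P r s) :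
    ∑ z, (blockBuckets r s z)⁻¹ * indepW P z ^ 2 ≤ (m * distBound X Y W ε / 10000) ^ 2 := by
  rw [sum_inv_blockBuckets_mul]
  exact h.norm_mul_le (flatNorm_nonneg hr _ s) (flatNorm_nonneg hr _ s) hs.1 hs.2.1 hs.2.2

lemma EnoughSamples.Pr_dist_overestimated_le (h : EnoughSamples X Y W m α ε)
    {P r : X × Y × W → ℝ} (hP : IsProb P) (hr : IsProb r) (hind : P = indepW P) :
    Pr (batchW m P) (fun t => FlatSample m α P r t.1 ∧ distBound X Y W ε ≤ distStat r t) ≤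
      1 / 200 :=
  Pr_and_of_fst_le hP (by norm_num) fun s hs => Pr_distance_large_le hP hind h.pos
    (fun z => inv_nonneg.2 (zero_le_one.trans (one_le_blockBuckets hr s z)))
    (fun z => inv_le_one_of_one_le₀ (one_le_blockBuckets hr s z))
    (distBound_pos h.eps_pos) (h.sum_inv_blockBuckets_le hr hs)

lemma EnoughSamples.Pr_dist_underestimated_le (h : EnoughSamples X Y W m α ε)
    {P r : X × Y × W → ℝ} (hP : IsProb P) (hr : IsProb r)
    (hfar : ε ≤ ∑ z, |P z - indepW P z|) :
    Pr (batchW m P) (fun t => FlatSample m α P r t.1 ∧ distStat r t < distBound X Y W ε) ≤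
      1 / 200 := by
  refine Pr_and_of_fst_le hP (by norm_num) fun s hs => ?_
  have hX : (0 : ℝ) < Fintype.card X := by exact_mod_cast Fintype.card_pos
  have hY : (0 : ℝ) < Fintype.card Y := by exact_mod_cast Fintype.card_pos
  have hW : (0 : ℝ) < Fintype.card W := by exact_mod_cast Fintype.card_pos
  have hε := h.eps_pos
  have hS : 2 * distBound X Y W ε ≤
      ∑ z, (blockBuckets r s z)⁻¹ * (P z - indepW P z) ^ 2 := by
    -- Cauchy–Schwarz in Engel form, with buckets of total 27N; hence the 54 in `distBound`, half of
    -- the resulting lower bound.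
    have h1 := Finset.sq_sum_div_le_sum_sq_div Finset.univ (fun z => |P z - indepW P z|)
      (g := blockBuckets r s) fun z _ => zero_lt_one.trans_le (one_le_blockBuckets hr s z)
    rw [sum_blockBuckets h.pos hr] at h1
    simp only [sq_abs, div_eq_inv_mul _ (blockBuckets r s _)] at h1
    refine le_trans ?_ h1
    calc 2 * distBound X Y W ε =
          ε ^ 2 / (27 * (Fintype.card X * Fintype.card Y * Fintype.card W)) := by
          unfold distBound
          field_simp
          norm_num
      _ ≤ _ := by gcongr
  refine Pr_distance_small_le hP h.pos
    (fun z => inv_nonneg.2 (zero_le_one.trans (one_le_blockBuckets hr s z)))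
    (fun z => inv_le_one_of_one_le₀ (one_le_blockBuckets hr s z))
    (distBound_pos hε) (h.sum_inv_blockBuckets_le hr hs) hS ?_
  calc (1 : ℝ) ≤ (m / 10000) ^ 2 * (2 * distBound X Y W ε) := by
        have h1 := h.card_mul_le
        unfold distBound
        rw [show ((m : ℝ) / 10000) ^ 2 * (2 * (ε ^ 2 / (54 * (Fintype.card X * Fintype.card Y *
          Fintype.card W)))) = (m ^ 2 * ε ^ 2) / (27 * 10 ^ 8 * (Fintype.card X * Fintype.card Y *
          Fintype.card W)) by field_simp; ring, one_le_div (by positivity)]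
        have : (0 : ℝ) < Fintype.card X * Fintype.card Y * Fintype.card W := by positivity
        linarith
    _ ≤ _ := by gcongr

lemma EnoughSamples.Pr_freq_far_le {V : Type*} [Fintype V] [DecidableEq V] [Nonempty V]
    (h : EnoughSamples X Y W m α ε) {P : X × Y × W → ℝ} (hP : IsProb P) (π : X × Y × W → V)
    (hV : (Fintype.card V : ℝ) ^ 2 ≤ Fintype.card X * Fintype.card Y * Fintype.card W) :
    Pr (batchW m P) (fun t => ε / 4 ≤ ∑ y, |freq π t.1 y - marg P π y|) ≤ 1 / 200 := by
  rw [batchW, Pr_prodW_fst _ ((hP.quadW.powW m).prodW (hP.quadW.powW m))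
    fun s => ε / 4 ≤ ∑ y, |freq π s y - marg P π y|]
  have hε := h.eps_pos
  refine AugIndep.Pr_freq_far_le hP h.pos π (by positivity) ?_
  have h1 := h.le_mul_sq hV
  have h2 := one_le_card_real V
  have : (1 / 200 : ℝ) * (m * (ε / 4) ^ 2) = m * ε ^ 2 / 3200 := by ring
  rw [this]
  linarith

/-- It is unlikely that the flattening fails and the prediction is not declared inaccurate. -/
lemma EnoughSamples.Pr_not_flat_le (h : EnoughSamples X Y W m α ε)
    {P r : X × Y × W → ℝ} (hP : IsProb P) (hr : IsProb r) :
    Pr (batchW m P) (fun t => normStat r t < 20 * normBound Y m α ∧ ¬ FlatSample m α P r t.1) ≤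
      3 / 200 := by
  have hpr := hP.batchW m
  have h1 := h.Pr_flatNorm_outer_le hP hr (fun t => t.1) h.card_left
  have h2 := h.Pr_flatNorm_outer_le hP hr (fun t => t.2.2) h.card_right
  have h3 := h.Pr_norm_underestimated_le hP hr
  refine (Pr_mono hpr fun t ht => ?_).trans ((Pr_or_le hpr _ _).trans (add_le_add h1
    ((Pr_or_le hpr _ _).trans (add_le_add h2 h3)))) |>.trans (by norm_num)
  by_contra hcon
  push Not at hcon
  exact ht.2 ⟨hcon.1, hcon.2.2 ht.1, hcon.2.1⟩

/-! ### The three guarantees of the block tester. -/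

lemma EnoughSamples.blockTester_accurate (h : EnoughSamples X Y W m α ε) (𝒜 : Set (X → ℝ))
    (ℬ : Set (W → ℝ)) {P r : X × Y × W → ℝ} (hP : IsProb P) (hr : IsProb r)
    (hPr : ∑ z, |P z - r z| ≤ 2 * α) :
    Pr (batchW m P) (fun t => blockTester m α ε 𝒜 ℬ r t = Answer.inaccurateInformation) ≤
      1 / 20 := by
  refine (Pr_mono (hP.batchW m) fun t ht => ?_).trans (h.Pr_inaccurate_le hP hr hPr)
  unfold blockTester at ht
  split_ifs at ht with h1
  assumption

/-- Rejection presupposes a passed norm check, so flatness fails with probability at most 3/200; the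
distance and the two learning errors add 1/200 each. -/
lemma EnoughSamples.blockTester_product (h : EnoughSamples X Y W m α ε) {𝒜 : Set (X → ℝ)}
    {ℬ : Set (W → ℝ)} {P r : X × Y × W → ℝ} (hP : IsProb P) (hr : IsProb r)
    (hind : P = indepW P) (h𝒜 : marg P (fun t => t.1) ∈ 𝒜)
    (hℬ : marg P (fun t => t.2.2) ∈ ℬ) :
    Pr (batchW m P) (fun t => blockTester m α ε 𝒜 ℬ r t = Answer.reject) ≤ 1 / 20 := by
  have hpr := hP.batchW m
  have h1 := h.Pr_not_flat_le hP hr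
  have h2 := h.Pr_dist_overestimated_le hP hr hind
  have h3 := h.Pr_freq_far_le hP (fun t => t.1) h.card_left
  have h4 := h.Pr_freq_far_le hP (fun t => t.2.2) h.card_right
  refine (Pr_mono hpr fun t ht => ?_).trans ((Pr_or_le hpr _ _).trans (add_le_add h1
    ((Pr_or_le hpr _ _).trans (add_le_add h2 ((Pr_or_le hpr _ _).trans (add_le_add h3 h4))))))
    |>.trans (by norm_num)
  unfold blockTester at ht
  split_ifs at ht with hn hd
  by_cases hf : FlatSample m α P r t.1
  · rcases hd with hd | hd | hd
    · exact Or.inr (Or.inl ⟨hf, hd⟩)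
    · push Not at hd
      exact Or.inr (Or.inr (Or.inl (hd _ h𝒜)))
    · push Not at hd
      exact Or.inr (Or.inr (Or.inr (hd _ hℬ)))
  · exact Or.inl ⟨not_le.1 hn, hf⟩

lemma le_sum_abs_of_close {V : Type*} [Fintype V] {f p a : V → ℝ} (h : ε / 2 ≤ ∑ y, |p y - a y|)
    (hf : ∑ y, |f y - a y| < ε / 4) : ε / 4 ≤ ∑ y, |f y - p y| := by
  have : ∑ y, |p y - a y| ≤ ∑ y, |f y - p y| + ∑ y, |f y - a y| := by
    rw [← Finset.sum_add_distrib]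
    refine Finset.sum_le_sum fun y _ => ?_
    rw [abs_sub_comm (f y) (p y)]
    exact abs_sub_le _ _ _
  linarith

lemma EnoughSamples.blockTester_far (h : EnoughSamples X Y W m α ε) {𝒜 : Set (X → ℝ)}
    {ℬ : Set (W → ℝ)} {P r : X × Y × W → ℝ} (hP : IsProb P) (hr : IsProb r)
    (hfar : ε ≤ ∑ z, |P z - indepW P z| ∨
      (∀ a ∈ 𝒜, ε / 2 ≤ ∑ x, |marg P (fun t => t.1) x - a x|) ∨
      (∀ b ∈ ℬ, ε / 2 ≤ ∑ x, |marg P (fun t => t.2.2) x - b x|)) :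
    Pr (batchW m P) (fun t => blockTester m α ε 𝒜 ℬ r t = Answer.accept) ≤ 1 / 20 := by
  have hpr := hP.batchW m
  have h1 := h.Pr_not_flat_le hP hr
  -- Acceptance requires every check to pass, so each alternative in `hfar` needs only the failure
  -- of the check that detects it.
  have key : ∀ E : Batches m (X × Y × W) → Prop, Pr (batchW m P) E ≤ 1 / 200 →
      (∀ t, blockTester m α ε 𝒜 ℬ r t = Answer.accept → FlatSample m α P r t.1 → E t) →
      Pr (batchW m P) (fun t => blockTester m α ε 𝒜 ℬ r t = Answer.accept) ≤ 1 / 20 := by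
    intro E hE himp
    refine (Pr_mono hpr fun t ht => ?_).trans ((Pr_or_le hpr _ _).trans (add_le_add h1 hE))
      |>.trans (by norm_num)
    by_cases hf : FlatSample m α P r t.1
    · exact Or.inr (himp t ht hf)
    · refine Or.inl ⟨?_, hf⟩
      unfold blockTester at ht
      split_ifs at ht with hn hd
      exact not_le.1 hn
  rcases hfar with hfar | hfar | hfar
  · refine key _ (h.Pr_dist_underestimated_le hP hr hfar) fun t ht hf => ⟨hf, ?_⟩
    unfold blockTester at ht
    split_ifs at ht with hn hd
    push Not at hd
    exact hd.1
  · refine key _ (h.Pr_freq_far_le hP (fun t => t.1) h.card_left) fun t ht _ => ?_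
    unfold blockTester at ht
    split_ifs at ht with hn hd
    push Not at hd
    obtain ⟨a, ha, hlt⟩ := hd.2.1
    exact le_sum_abs_of_close (hfar a ha) hlt
  · refine key _ (h.Pr_freq_far_le hP (fun t => t.2.2) h.card_right) fun t ht _ => ?_
    unfold blockTester at ht
    split_ifs at ht with hn hd
    push Not at hd
    obtain ⟨b, hb, hlt⟩ := hd.2.2
    exact le_sum_abs_of_close (hfar b hb) hlt

end BlockTester

/-! ### Realizing the batches by independent samples. -/

section Realization

variable {Ω T T' : Type*}

/-- The weights `V p` arise, for every `p`, from `M` independent draws from `p` by relabelling. -/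
def Realizable (M : ℕ) (V : (Ω → ℝ) → T → ℝ) : Prop :=
  ∃ φ : (Fin M → Ω) ≃ T, ∀ p s, V p (φ s) = ∏ j, p (s j)

lemma Realizable.of_equiv (e : Ω ≃ T) : Realizable 1 fun (p : Ω → ℝ) t => p (e.symm t) :=
  ⟨(Equiv.funUnique (Fin 1) Ω).trans e, fun p s => by simp⟩

lemma Realizable.prodW {M M' : ℕ} {V : (Ω → ℝ) → T → ℝ} {V' : (Ω → ℝ) → T' → ℝ}
    (h : Realizable M V) (h' : Realizable M' V') :
    Realizable (M + M') fun p => prodW (V p) (V' p) := by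
  obtain ⟨φ, hφ⟩ := h
  obtain ⟨φ', hφ'⟩ := h'
  refine ⟨(Fin.appendEquiv M M').symm.trans (Equiv.prodCongr φ φ'), fun p s => ?_⟩
  simp [AugIndep.prodW, Fin.appendEquiv, hφ, hφ', Fin.prod_univ_add]

lemma Realizable.powW {M : ℕ} {V : (Ω → ℝ) → T → ℝ} (h : Realizable M V) (m : ℕ) :
    Realizable (m * M) fun p => powW (V p) m := by
  obtain ⟨φ, hφ⟩ := h
  refine ⟨((Equiv.arrowCongr finProdFinEquiv.symm (Equiv.refl Ω)).trans
    (Equiv.curry (Fin m) (Fin M) Ω)).trans (Equiv.piCongrRight fun _ => φ), fun p s => ?_⟩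
  simp only [AugIndep.powW, Equiv.trans_apply, Equiv.piCongrRight_apply, Pi.map_apply, hφ]
  rw [← finProdFinEquiv.prod_comp, Fintype.prod_prod_type]
  rfl

/-- The count is 9 = 1 + 4 + 4: one batch of single draws and two of quadruples. -/
lemma Realizable.batchW (e : Ω ≃ T) (m : ℕ) :
    Realizable (9 * m) fun (p : Ω → ℝ) => batchW m fun t => p (e.symm t) := by
  have h1 := Realizable.of_equiv e
  have h4 := h1.prodW (h1.prodW (h1.prodW h1))
  have h := (h1.powW m).prodW ((h4.powW m).prodW (h4.powW m))
  rw [show m * 1 + (m * (1 + (1 + (1 + 1))) + m * (1 + (1 + (1 + 1)))) = 9 * m by ring] at h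
  exact h

lemma prob_pure_eq [Fintype Ω] [Fintype T] {M : ℕ} {V : (Ω → ℝ) → T → ℝ} (φ : (Fin M → Ω) ≃ T)
    (hφ : ∀ p s, V p (φ s) = ∏ j, p (s j)) (dec : PMF Ω → T → Answer) (phat p : PMF Ω)
    (o : Answer) :
    Tester.prob (fun r s => PMF.pure (dec r (φ s))) phat p o =
      Pr (V fun x => (p x).toReal) (fun t => dec phat t = o) := by
  classical
  rw [Tester.prob, Pr, Ex, ← φ.sum_comp]
  refine Finset.sum_congr rfl fun s _ => ?_
  rw [hφ, PMF.pure_apply]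
  by_cases h : dec phat (φ s) = o
  · simp [h]
  · simp [h, Ne.symm h]

end Realization

/-! ### Splitting the coordinates into blocks, and products across them. -/

section Blocks

set_option linter.unusedSectionVars false

variable {d : ℕ} {n : Fin d → ℕ} (k : Fin d)

/-- The coordinates before `k`. -/
abbrev LeftBlock (n : Fin d → ℕ) (k : Fin d) : Type := (i : {i // i < k}) → Fin (n i)

/-- The coordinates after `k`. -/
abbrev RightBlock (n : Fin d → ℕ) (k : Fin d) : Type := (i : {i // k < i}) → Fin (n i)

/-- Splitting the domain into the coordinates before, at and after `k`. -/
def blockEquiv : Domain n ≃ LeftBlock n k × Fin (n k) × RightBlock n k where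
  toFun x := (fun i => x i, x k, fun i => x i)
  invFun z i :=
    if h : i < k then z.1 ⟨i, h⟩
    else if h' : k < i then z.2.2 ⟨i, h'⟩
    else Fin.cast (congrArg n (le_antisymm (not_lt.1 h) (not_lt.1 h'))) z.2.1
  left_inv x := by
    funext i
    rcases lt_trichotomy i k with h | rfl | h
    · simp [h]
    · simp
    · simp [h, h.not_gt]
  right_inv z := by
    refine Prod.ext ?_ (Prod.ext ?_ ?_)
    · funext i
      simp [i.2]
    · simp
    · funext i
      simp [i.2, i.2.le]

lemma prod_eq_block_mul {M : Type*} [CommMonoid M] (F : Fin d → M) :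
    ∏ i, F i = (∏ i : {i // i < k}, F i) * F k * ∏ i : {i // k < i}, F i := by
  have h : ∀ i, F i = (if i < k then F i else 1) * (if i = k then F i else 1) *
      (if k < i then F i else 1) := by
    intro i
    rcases lt_trichotomy i k with h | rfl | h
    · simp [h, h.ne, h.le]
    · simp
    · simp [h, h.ne', h.le]
  rw [Finset.prod_congr rfl fun i _ => h i, Finset.prod_mul_distrib, Finset.prod_mul_distrib,
    Finset.prod_ite_eq' Finset.univ k F, ← Finset.prod_filter, ← Finset.prod_filter,
    ← Finset.prod_subtype (p := fun i => i < k) (Finset.univ.filter fun i => i < k) (by simp) F,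
    ← Finset.prod_subtype (p := fun i => k < i) (Finset.univ.filter fun i => k < i) (by simp) F]
  simp

/-- The largest `k` whose prefix product is at most √N works. Otherwise the next prefix and the
suffix after `k` would both exceed √N, yet they multiply to N. If `k` is last, the suffix is empty.
-/
lemma exists_balanced_index (hd : 1 ≤ d) (n : Fin d → ℕ) (hn : ∀ i, 1 ≤ n i) :
    ∃ k : Fin d, (∏ i : {i // i < k}, n i) ^ 2 ≤ ∏ i, n i ∧
      (∏ i : {i // k < i}, n i) ^ 2 ≤ ∏ i, n i := by
  have hN : 1 ≤ ∏ i, n i := Finset.one_le_prod' fun i _ => hn i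
  obtain ⟨k, hk, hmax⟩ := Finset.exists_max_image
    (Finset.univ.filter fun k : Fin d => (∏ i : {i // i < k}, n i) ^ 2 ≤ ∏ i, n i) id
    ⟨⟨0, hd⟩, by
      have : IsEmpty {i : Fin d // i < ⟨0, hd⟩} := ⟨fun i => by simpa [Fin.lt_def] using i.2⟩
      simpa using hN⟩
  simp only [Finset.mem_filter, Finset.mem_univ, true_and, id] at hk hmax
  refine ⟨k, hk, ?_⟩
  by_contra! hb
  by_cases hlast : (k : ℕ) + 1 < d
  · have hlt : k < (⟨k + 1, hlast⟩ : Fin d) := Fin.lt_def.2 (Nat.lt_succ_self _)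
    have hbig : ∏ i, n i < (∏ i : {i // i < (⟨k + 1, hlast⟩ : Fin d)}, n i) ^ 2 := by
      by_contra! hcon
      exact absurd (hmax _ hcon) (not_le.2 hlt)
    have hstep : ∏ i : {i // i < (⟨k + 1, hlast⟩ : Fin d)}, n i =
        (∏ i : {i // i < k}, n i) * n k := by
      rw [← Finset.prod_subtype (p := fun i => i < (⟨k + 1, hlast⟩ : Fin d))
          (Finset.univ.filter fun i => i < (⟨k + 1, hlast⟩ : Fin d)) (by simp) n,
        ← Finset.prod_subtype (p := fun i => i < k) (Finset.univ.filter fun i => i < k)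
          (by simp) n,
        show (Finset.univ.filter fun i => i < (⟨k + 1, hlast⟩ : Fin d)) =
          insert k (Finset.univ.filter fun i => i < k) by
            ext i
            simp only [Finset.mem_filter, Finset.mem_univ, true_and, Finset.mem_insert, Fin.lt_def,
              Fin.ext_iff]
            omega,
        Finset.prod_insert (by simp), mul_comm]
    have hsplit := prod_eq_block_mul k n
    rw [← hstep] at hsplit
    have := mul_lt_mul'' hbig hb (Nat.zero_le _) (Nat.zero_le _)
    rw [← mul_pow, ← hsplit, sq] at this
    exact lt_irrefl _ this
  · have : IsEmpty {i : Fin d // k < i} := ⟨fun i => by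
      have := Fin.lt_def.1 i.2
      have := i.1.2
      omega⟩
    simp at hb
    omega

variable (p : PMF (Domain n))

/-- The weights of `p` on the three blocks. -/
noncomputable def blockPMF (z : LeftBlock n k × Fin (n k) × RightBlock n k) : ℝ :=
  (p ((blockEquiv k).symm z)).toReal

lemma sum_toReal_eq_one {Ω : Type*} [Fintype Ω] (p : PMF Ω) : ∑ x, (p x).toReal = 1 := by
  have h := p.tsum_coe
  rw [tsum_fintype] at h
  rw [← ENNReal.toReal_sum fun x _ => p.apply_ne_top x, h, ENNReal.toReal_one]

lemma isProb_toReal {Ω : Type*} [Fintype Ω] (p : PMF Ω) : IsProb fun x => (p x).toReal :=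
  ⟨fun _ => ENNReal.toReal_nonneg, sum_toReal_eq_one p⟩

lemma isProb_blockPMF : IsProb (blockPMF k p) where
  nonneg _ := ENNReal.toReal_nonneg
  sum_eq_one := by
    rw [← sum_toReal_eq_one p]
    exact (blockEquiv k).symm.sum_comp fun x => (p x).toReal

lemma two_mul_tvDist (q : PMF (Domain n)) :
    ∑ z, |blockPMF k p z - blockPMF k q z| = 2 * tvDist p q := by
  rw [tvDist, ← (blockEquiv k).symm.sum_comp fun x => |(p x).toReal - (q x).toReal|]
  simp only [blockPMF]
  ring

/-- The product distribution with given factors. -/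
noncomputable def productPMF (q : (i : Fin d) → PMF (Fin (n i))) : PMF (Domain n) :=
  PMF.ofFintype (fun x => ∏ i, q i (x i)) (by
    rw [← Fintype.prod_sum]
    exact Finset.prod_eq_one fun i _ => (tsum_fintype _).symm.trans (q i).tsum_coe)

lemma isProduct_productPMF (q : (i : Fin d) → PMF (Fin (n i))) : IsProduct (productPMF q) :=
  ⟨q, fun x => PMF.ofFintype_apply _ x⟩

/-- The product weights on the coordinates in a subset. -/
noncomputable def subProduct (S : Fin d → Prop) [DecidablePred S]
    (q : (i : Fin d) → PMF (Fin (n i)))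
    (x : (i : {i // S i}) → Fin (n i)) : ℝ :=
  ∏ i : {i // S i}, (q i (x i)).toReal

lemma isProb_subProduct (S : Fin d → Prop) [DecidablePred S]
    (q : (i : Fin d) → PMF (Fin (n i))) : IsProb (subProduct S q) where
  nonneg x := Finset.prod_nonneg fun i _ => ENNReal.toReal_nonneg
  sum_eq_one := by
    simp only [subProduct]
    rw [← Fintype.prod_sum (f := fun (i : {i // S i}) (j : Fin (n i)) => (q i j).toReal)]
    exact Finset.prod_eq_one fun i _ => sum_toReal_eq_one _

lemma blockPMF_of_product {q : (i : Fin d) → PMF (Fin (n i))} (h : ∀ x, p x = ∏ i, q i (x i))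
    (z : LeftBlock n k × Fin (n k) × RightBlock n k) :
    blockPMF k p z = subProduct (fun i => i < k) q z.1 * (q k z.2.1).toReal *
      subProduct (fun i => k < i) q z.2.2 := by
  obtain ⟨x, rfl⟩ := (blockEquiv k).surjective z
  rw [blockPMF, Equiv.symm_apply_apply, h, ENNReal.toReal_prod, prod_eq_block_mul k]
  rfl

lemma marg_of_mul {X Y W : Type*} [Fintype X] [Fintype Y] [Fintype W] [DecidableEq X]
    [DecidableEq Y] [DecidableEq W] {P : X × Y × W → ℝ} {A : X → ℝ} {B : Y → ℝ} {C : W → ℝ}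
    (hA : IsProb A) (hB : IsProb B) (hC : IsProb C)
    (h : ∀ z, P z = A z.1 * B z.2.1 * C z.2.2) :
    marg P (fun t => t.1) = A ∧ marg P (fun t => t.2.1) = B ∧ marg P (fun t => t.2.2) = C := by
  refine ⟨funext fun x => ?_, funext fun y => ?_, funext fun w => ?_⟩ <;>
    simp only [marg, Ex, h, Fintype.sum_prod_type, mul_ite, mul_one, mul_zero]
  · rw [Finset.sum_eq_single x (fun x' _ hx' => by simp [hx']) (by simp)]
    simp [← Finset.mul_sum, hB.sum_eq_one, hC.sum_eq_one]
  · have : ∀ x, ∑ y', ∑ w, (if y' = y then A x * B y' * C w else 0) = A x * B y := by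
      intro x
      rw [Finset.sum_eq_single y (fun y' _ hy' => by simp [hy']) (by simp)]
      simp [← Finset.mul_sum, hC.sum_eq_one]
    simp only [this, ← Finset.sum_mul, hA.sum_eq_one, one_mul]
  · simp [← Finset.mul_sum, ← Finset.sum_mul, hA.sum_eq_one, hB.sum_eq_one]

lemma marg_blockPMF_mid (y : Fin (n k)) :
    marg (blockPMF k p) (fun t => t.2.1) y = (p.map (fun x => x k) y).toReal := by
  rw [PMF.map_apply, tsum_fintype, ENNReal.toReal_sum fun x _ => by
    split_ifs
    · exact p.apply_ne_top x
    · simp, marg, Ex, ← (blockEquiv k).sum_comp]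
  refine Finset.sum_congr rfl fun x _ => ?_
  rw [blockPMF, Equiv.symm_apply_apply, show (blockEquiv k x).2.1 = x k from rfl]
  by_cases h : x k = y
  · simp [h]
  · simp [h, Ne.symm h]

/-- Replacing the two outer factors of a product changes it by at most the sum of their
`ℓ¹` changes. -/
lemma sum_abs_mul_sub_mul_le {X Y W : Type*} [Fintype X] [Fintype Y] [Fintype W]
    {A A' : X → ℝ} {B : Y → ℝ} {C C' : W → ℝ} (hA' : IsProb A') (hB : IsProb B)
    (hC : IsProb C) :
    ∑ z : X × Y × W, |A z.1 * B z.2.1 * C z.2.2 - A' z.1 * B z.2.1 * C' z.2.2| ≤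
      ∑ x, |A x - A' x| + ∑ w, |C w - C' w| := by
  have h : ∀ z : X × Y × W, |A z.1 * B z.2.1 * C z.2.2 - A' z.1 * B z.2.1 * C' z.2.2| ≤
      |A z.1 - A' z.1| * B z.2.1 * C z.2.2 + A' z.1 * B z.2.1 * |C z.2.2 - C' z.2.2| := by
    intro z
    calc _ = |(A z.1 - A' z.1) * B z.2.1 * C z.2.2 +
          A' z.1 * B z.2.1 * (C z.2.2 - C' z.2.2)| := by ring_nf
      _ ≤ _ := abs_add_le _ _
      _ = _ := by
        simp only [abs_mul, abs_of_nonneg (hA'.nonneg _), abs_of_nonneg (hB.nonneg _),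
          abs_of_nonneg (hC.nonneg _)]
  refine (Finset.sum_le_sum fun z _ => h z).trans_eq ?_
  simp only [Finset.sum_add_distrib, Fintype.sum_prod_type, ← Finset.mul_sum, ← Finset.sum_mul,
    hA'.sum_eq_one, hB.sum_eq_one, hC.sum_eq_one, mul_one, one_mul]

/-- By contraposition: replacing `p` by the product of its block marginals, and then the outer
marginals by nearby products, costs less than ε + ε/2 + ε/2 = 2ε in ℓ¹, which is less than ε in
total variation. -/
lemma far_blocks {ε : ℝ} (h : IsFarFromProduct ε p) :
    ε ≤ ∑ z, |blockPMF k p z - indepW (blockPMF k p) z| ∨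
      (∀ a ∈ Set.range (subProduct (n := n) fun i => i < k),
        ε / 2 ≤ ∑ x, |marg (blockPMF k p) (fun t => t.1) x - a x|) ∨
      (∀ b ∈ Set.range (subProduct (n := n) fun i => k < i),
        ε / 2 ≤ ∑ x, |marg (blockPMF k p) (fun t => t.2.2) x - b x|) := by
  by_contra! hcon
  obtain ⟨h1, ⟨_, ⟨q, rfl⟩, h2⟩, ⟨_, ⟨q', rfl⟩, h3⟩⟩ := hcon
  -- The close product takes its outer factors from the two approximations and its factor at `k`
  -- from `p` itself, so the middle block contributes no error.
  set Q : (i : Fin d) → PMF (Fin (n i)) := fun i =>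
    if i < k then q i else if k < i then q' i else p.map fun x => x i with hQ
  have hP := isProb_blockPMF k p
  have hleft : subProduct (fun i => i < k) Q = subProduct (fun i => i < k) q := by
    funext x
    exact Finset.prod_congr rfl fun i _ => by simp [hQ, i.2]
  have hright : subProduct (fun i => k < i) Q = subProduct (fun i => k < i) q' := by
    funext x
    exact Finset.prod_congr rfl fun i _ => by simp [hQ, i.2, i.2.not_gt]
  have hmid : ∀ y, (Q k y).toReal = marg (blockPMF k p) (fun t => t.2.1) y := fun y => by
    rw [marg_blockPMF_mid]
    simp [hQ]
  have h4 := h _ (isProduct_productPMF Q)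
  have h5 := two_mul_tvDist k p (productPMF Q)
  have h6 : ∀ z, blockPMF k (productPMF Q) z = subProduct (fun i => i < k) q z.1 *
      marg (blockPMF k p) (fun t => t.2.1) z.2.1 * subProduct (fun i => k < i) q' z.2.2 := by
    intro z
    rw [blockPMF_of_product k (productPMF Q) (fun x => PMF.ofFintype_apply _ x), hleft, hright,
      hmid]
  have h7 : ∑ z, |blockPMF k p z - blockPMF k (productPMF Q) z| ≤
      ∑ z, |blockPMF k p z - indepW (blockPMF k p) z| +
        ∑ z, |indepW (blockPMF k p) z - blockPMF k (productPMF Q) z| := by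
    rw [← Finset.sum_add_distrib]
    exact Finset.sum_le_sum fun z _ => abs_sub_le _ _ _
  have h8 := sum_abs_mul_sub_mul_le (A := marg (blockPMF k p) fun t => t.1)
    (C' := subProduct (fun i => k < i) q') (isProb_subProduct (fun i => i < k) q)
    (hP.marg fun t => t.2.1) (hP.marg fun t => t.2.2)
  simp only [← h6] at h8
  simp only [indepW] at h1 h7
  linarith

lemma product_blocks (h : IsProduct p) :
    blockPMF k p = indepW (blockPMF k p) ∧
      marg (blockPMF k p) (fun t => t.1) ∈ Set.range (subProduct (n := n) fun i => i < k) ∧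
      marg (blockPMF k p) (fun t => t.2.2) ∈ Set.range (subProduct (n := n) fun i => k < i) := by
  obtain ⟨q, hq⟩ := h
  have h1 := blockPMF_of_product k p hq
  obtain ⟨hA, hB, hC⟩ := marg_of_mul (isProb_subProduct _ q) (isProb_toReal (q k))
    (isProb_subProduct _ q) h1
  refine ⟨funext fun z => ?_, ⟨q, hA.symm⟩, ⟨q, hC.symm⟩⟩
  rw [indepW, hA, hB, hC, h1]

set_option synthInstance.maxSize 1000 in
lemma exists_tester_of_enoughSamples (hn : ∀ i, 1 ≤ n i) {m : ℕ} {α ε : ℝ}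
    (h : EnoughSamples (LeftBlock n k) (Fin (n k)) (RightBlock n k) m α ε) :
    ∃ A : Tester (9 * m) (Domain n), IsAugmentedIndependenceTester α ε 0.1 A := by
  have : ∀ i, Nonempty (Fin (n i)) := fun i => ⟨⟨0, hn i⟩⟩
  obtain ⟨φ, hφ⟩ := Realizable.batchW (blockEquiv (n := n) k) m
  let dec : PMF (Domain n) → Batches m (LeftBlock n k × Fin (n k) × RightBlock n k) → Answer :=
    fun phat => blockTester m α ε (Set.range (subProduct (n := n) fun i => i < k))
      (Set.range (subProduct (n := n) fun i => k < i)) (blockPMF k phat)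
  have hprob := prob_pure_eq φ hφ dec
  have hδ : (0.1 / 2 : ℝ) = 1 / 20 := by norm_num
  refine ⟨fun r s => PMF.pure (dec r (φ s)), ⟨fun p phat hp => ?_, fun p phat hp => ?_, fun p phat hp => ?_⟩⟩
  · rw [hprob, hδ]
    refine h.blockTester_accurate _ _ (isProb_blockPMF k p) (isProb_blockPMF k phat) ?_
    exact (two_mul_tvDist k p phat).trans_le (by linarith)
  · rw [hprob, hδ]
    exact h.blockTester_far (isProb_blockPMF k p) (isProb_blockPMF k phat) (far_blocks k p hp)
  · rw [hprob, hδ]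
    obtain ⟨h1, h2, h3⟩ := product_blocks k p hp
    exact h.blockTester_product (isProb_blockPMF k p) (isProb_blockPMF k phat) h1 h2 h3

end Blocks

end AugIndep

/-! ### Choice of the split and of the sample size. -/

theorem theorem4 :
    ∃ C : ℝ, ∀ (d : ℕ) (hd : 1 ≤ d) (n : Fin d → ℕ), Antitone n → (∀ i, 2 ≤ n i) →
      ∀ ε : ℝ, 0 < ε → ε < 1 → ∀ α : ℝ, 0 ≤ α → α ≤ 1 →
        ∃ (m : ℕ) (A : AugIndep.Tester m (AugIndep.Domain n)),
          AugIndep.IsAugmentedIndependenceTester α ε 0.1 A ∧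
          (m : ℝ) ≤ C * max
            (Real.sqrt (∏ i, (n i : ℝ)) / ε ^ 2)
            ((n ⟨0, hd⟩ : ℝ) ^ (1 / 3 : ℝ) * (∏ i, (n i : ℝ)) ^ (1 / 3 : ℝ) * α ^ (1 / 3 : ℝ)
              / ε ^ (4 / 3 : ℝ)) := by
  refine ⟨10 ^ 11, fun d hd n hanti hn2 ε hε0 hε1 α hα0 hα1 => ?_⟩
  have hn : ∀ i, 1 ≤ n i := fun i => one_le_two.trans (hn2 i)
  obtain ⟨k, hkl, hkr⟩ := AugIndep.exists_balanced_index hd n hn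
  set N : ℝ := ∏ i, (n i : ℝ) with hN
  set B : ℝ := max (Real.sqrt N / ε ^ 2)
    ((n ⟨0, hd⟩ : ℝ) ^ (1 / 3 : ℝ) * N ^ (1 / 3 : ℝ) * α ^ (1 / 3 : ℝ) / ε ^ (4 / 3 : ℝ)) with hB
  have hN1 : 1 ≤ N := by
    rw [hN]
    exact_mod_cast Finset.one_le_prod' fun i _ => hn i
  have hN0 : 0 ≤ N := zero_le_one.trans hN1
  have hB1 : 1 ≤ B := by
    refine le_trans ?_ (le_max_left _ _)
    rw [one_le_div (by positivity)]
    exact (pow_le_one₀ hε0.le hε1.le).trans (Real.one_le_sqrt.2 hN1)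
  -- The factor 10¹⁰ squares to the 10²⁰ in `le_sq`; its cube 10³⁰ exceeds the 10²⁰ in `le_cube`.
  set m : ℕ := ⌈(10 : ℝ) ^ 10 * B⌉₊ with hm
  have hmB : (10 : ℝ) ^ 10 * B ≤ m := Nat.le_ceil _
  have hcards : (Fintype.card (AugIndep.LeftBlock n k) : ℝ) * Fintype.card (Fin (n k)) *
      Fintype.card (AugIndep.RightBlock n k) = N := by
    rw [hN, AugIndep.prod_eq_block_mul k]
    simp [Fintype.card_pi]
  have hsq : 10 ^ 20 * N ≤ m ^ 2 * ε ^ 4 := by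
    have h1 : 10 ^ 10 * (Real.sqrt N / ε ^ 2) ≤ m := by
      refine le_trans ?_ hmB
      gcongr
      exact le_max_left _ _
    have h2 : 10 ^ 10 * Real.sqrt N ≤ m * ε ^ 2 := by
      rwa [← mul_div_assoc, div_le_iff₀ (by positivity)] at h1
    calc 10 ^ 20 * N = (10 ^ 10 * Real.sqrt N) ^ 2 := by
          rw [mul_pow, Real.sq_sqrt hN0]
          norm_num
      _ ≤ (m * ε ^ 2) ^ 2 := by gcongr
      _ = _ := by ring
  have hcube : 10 ^ 20 * (n k * N * α) ≤ m ^ 3 * ε ^ 4 := by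
    have h1 : 10 ^ 10 * ((n ⟨0, hd⟩ : ℝ) ^ (1 / 3 : ℝ) * N ^ (1 / 3 : ℝ) * α ^ (1 / 3 : ℝ) /
        ε ^ (4 / 3 : ℝ)) ≤ m := by
      refine le_trans ?_ hmB
      gcongr
      exact le_max_right _ _
    have h2 : 10 ^ 10 * ((n ⟨0, hd⟩ : ℝ) ^ (1 / 3 : ℝ) * N ^ (1 / 3 : ℝ) * α ^ (1 / 3 : ℝ)) ≤
        m * ε ^ (4 / 3 : ℝ) := by
      rwa [← mul_div_assoc, div_le_iff₀ (by positivity)] at h1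
    have hroot : ∀ x : ℝ, 0 ≤ x → (x ^ (1 / 3 : ℝ)) ^ 3 = x := fun x hx => by
      rw [← Real.rpow_natCast, ← Real.rpow_mul hx]
      norm_num
    have hroot4 : (ε ^ (4 / 3 : ℝ)) ^ 3 = ε ^ 4 := by
      rw [← Real.rpow_natCast, ← Real.rpow_mul hε0.le, ← Real.rpow_natCast]
      norm_num
    have hk0 : (n k : ℝ) ≤ n ⟨0, hd⟩ := by
      exact_mod_cast hanti (Fin.le_def.2 (Nat.zero_le _))
    calc 10 ^ 20 * (n k * N * α) ≤ 10 ^ 30 * (n ⟨0, hd⟩ * N * α) := by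
          gcongr
          · norm_num
          · norm_num
      _ = (10 ^ 10 * ((n ⟨0, hd⟩ : ℝ) ^ (1 / 3 : ℝ) * N ^ (1 / 3 : ℝ) * α ^ (1 / 3 : ℝ))) ^ 3 := by
          rw [mul_pow, mul_pow, mul_pow, hroot _ (Nat.cast_nonneg _), hroot _ hN0, hroot _ hα0]
          norm_num
      _ ≤ (m * ε ^ (4 / 3 : ℝ)) ^ 3 := by gcongr
      _ = _ := by rw [mul_pow, hroot4]
  have henough : AugIndep.EnoughSamples (AugIndep.LeftBlock n k) (Fin (n k))
      (AugIndep.RightBlock n k) m α ε := by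
    refine ⟨hε0, hε1, hα0, hα1, ?_, ?_, ?_, ?_⟩
    · rw [hcards, hN]
      simp only [Fintype.card_pi, Fintype.card_fin]
      exact_mod_cast hkl
    · rw [hcards, hN]
      simp only [Fintype.card_pi, Fintype.card_fin]
      exact_mod_cast hkr
    · rwa [hcards]
    · rwa [hcards, Fintype.card_fin]
  obtain ⟨A, hA⟩ := AugIndep.exists_tester_of_enoughSamples k hn henough
  refine ⟨9 * m, A, hA, ?_⟩
  -- Since B ≥ 1, the rounding is absorbed: 9(10¹⁰B + 1) ≤ 10¹¹B.
  have hmle : (m : ℝ) < 10 ^ 10 * B + 1 := Nat.ceil_lt_add_one (by positivity)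
  push_cast
  linarith
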